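/- Conventions. All graphs are finite and simple. $P_n$ is the path on $n$ vertices. For a graph $G$ and a positive integer $k$, $G^k$ is the graph on $V(G)$ in which two distinct vertices are adjacent if and only if their distance in $G$ is at most $k$. For a graph $H$ and a positive integer $t$, let $H(t)$ be the graph obtained by replacing every vertex $v$ of $H$ by a clique $C(v)$ on $t$ vertices and adding all edges between $C(u)$ and $C(v)$ for every $uv\in E(H)$. A graph $H\{t\}$ is any graph obtained from $H(t)$ by removing, for every $uv\in E(H)$, a perfect matching from the complete bipartite graph between $C(u)$ and $C(v)$ (so $H\{t\}$ is not unique). We write $G\to(H)_s$ if every colouring of $E(G)$ with $s$ colours contains a monochromatic (not necessarily induced) copy of $H$. A quadruple of positive real numbers $(a,b,c,\varepsilon)$ is good if $a\ge 2c+1$, $b\ge 264a^2\varepsilon^{-2}c^{-2}$ and $\varepsilon<1/10$. For positive reals $a,b,c,\varepsilon$ and positive integers $t,n$, let $\mathcal P(a,b,c,t,\varepsilon,n)$ be the class of all graphs $G$ such that 1. $|V(G)|=\lceil an\rceil$; 2. the maximum degree of $G$ is at most $b$; 3. there is $f_G>0$ such that for all disjoint $X,Y\subseteq V(G)$ with $|X|=|Y|=\lceil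 cn\rceil$ we have $(1-\varepsilon)f_G\le \dfrac{e_G(X,Y)}{|X||Y|}\le(1+\varepsilon)f_G$, where $e_G(X,Y)$ is the number of edges between $X$ and $Y$; 4. $G$ has no cycle of length at most $2t$. Proposition. For all positive integers $k$ and $s$ there exist positive integers $r$ and $t$ and a good quadruple $(a,b,c,\varepsilon)$ such that, for all sufficiently large $n$, every $G\in\mathcal P(a,b,c,t,\varepsilon,n)$ and every choice of the graph $G^r\{t\}$ satisfy $$G^r\{t\}\to (P_n^k)_s .$$ -/

import Mathlib

namespace SizeRamsey

open SimpleGraph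

/-- The `k`-th power `G ^ k`: distinct vertices are adjacent iff their distance in `G` is at most `k`
(the extended distance is `⊤` between different components). -/
def graphPower {V : Type*} (G : SimpleGraph V) (k : ℕ) : SimpleGraph V where
  Adj u v := u ≠ v ∧ G.edist u v ≤ (k : ℕ∞)
  symm := ⟨fun u v h => ⟨h.1.symm, by rw [SimpleGraph.edist_comm]; exact h.2⟩⟩
  loopless := ⟨fun _ h => h.1 rfl⟩

/-- The complete blow-up `H(t)`: every vertex `v` becomes a clique `C(v) = {v} × Fin t`, and all edges
between `C(u)` and `C(v)` are present whenever `uv` is an edge of `H`. -/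
def completeBlowup {V : Type*} (H : SimpleGraph V) (t : ℕ) : SimpleGraph (V × Fin t) where
  Adj x y := (x.1 = y.1 ∧ x.2 ≠ y.2) ∨ H.Adj x.1 y.1
  symm := ⟨fun _ _ h => h.imp (fun h => ⟨h.1.symm, h.2.symm⟩) (fun h => h.symm)⟩
  loopless := ⟨fun x h => h.elim (fun h => h.2 rfl) (fun h => H.loopless.irrefl x.1 h)⟩

/-- `K` is a sheared complete blow-up `H{t}`: it is obtained from `H(t)` by deleting, for every edge
`uv` of `H`, a perfect matching between `C(u)` and `C(v)`. Here `M` is the graph of deleted edges; it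
has edges only between cliques of adjacent vertices, and for every edge `uv` of `H` each vertex of
`C(u)` has exactly one `M`-neighbour in `C(v)` (and vice versa, exchanging `u` and `v`). -/
def IsShearedBlowup {V : Type*} (H : SimpleGraph V) (t : ℕ) (K : SimpleGraph (V × Fin t)) : Prop :=
  ∃ M : SimpleGraph (V × Fin t),
    (∀ x y, M.Adj x y → H.Adj x.1 y.1) ∧
    (∀ u v, H.Adj u v → ∀ i : Fin t, ∃! j : Fin t, M.Adj (u, i) (v, j)) ∧
    K = completeBlowup H t \ M

/-- `K → (H)_s`: every `s`-colouring of the edges of `K` contains a monochromatic copy of `H`, i.e.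
some colour class contains `H` as a (not necessarily induced) subgraph. -/
def Arrows {V W : Type*} (K : SimpleGraph V) (H : SimpleGraph W) (s : ℕ) : Prop :=
  ∀ χ : K.EdgeLabeling (Fin s), ∃ i : Fin s, H.IsContained (χ.labelGraph i)

/-- Good quadruples of positive numbers `(a, b, c, ε)`. -/
structure IsGood (a b c ε : ℝ) : Prop where
  a_pos : 0 < a
  b_pos : 0 < b
  c_pos : 0 < c
  ε_pos : 0 < ε
  two_c_add_one_le : 2 * c + 1 ≤ a
  le_b : 264 * a ^ 2 / (ε ^ 2 * c ^ 2) ≤ b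
  ε_lt : ε < 1 / 10

/-- The class `𝒫(a, b, c, t, ε, n)` of pseudorandom graphs. The non-integral sizes `a n` and `c n`
are rounded up. -/
structure IsPseudorandom {V : Type*} [Fintype V] (G : SimpleGraph V) [DecidableRel G.Adj]
    (a b c : ℝ) (t : ℕ) (ε : ℝ) (n : ℕ) : Prop where
  card_eq : Fintype.card V = ⌈a * n⌉₊
  maxDegree_le : (G.maxDegree : ℝ) ≤ b
  density : ∃ f : ℝ, 0 < f ∧ ∀ X Y : Finset V, Disjoint X Y →
    X.card = ⌈c * n⌉₊ → Y.card = ⌈c * n⌉₊ →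
      (1 - ε) * f ≤ (G.edgeDensity X Y : ℝ) ∧ (G.edgeDensity X Y : ℝ) ≤ (1 + ε) * f
  no_short_cycle : ∀ (v : V) (p : G.Walk v v), p.IsCycle → 2 * t < p.length

end SizeRamsey

/-! The proof is an induction on the number of colours (`PathPowerRamsey`). Colourings become
coverings, and pseudorandomness becomes a weighting of the edges under which every two disjoint
`n`-sets carry weight between `1` and `ρ`. By Ramsey's theorem each `C(v)` contains a large clique
`B v` in one colour; only vertices with the majority colour `b` are kept. Two of them are related if
they are adjacent in the power of `G` and their cliques contain a complete pair of `2 * k`-sets in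
colour `b`. A path of `n + 2` related vertices gives the power of a path. Otherwise depth-first
search gives `ℓ` large sets with no related pair between two of them.

In that case colour `b` can be eliminated. Quasirandomness yields many disjoint paths of `G` with
one vertex in each set. They are the vertices of a new graph `G'`, whose edges come from edges of
`G` between the first two sets, and the `ℓ` vertices of a path act as a clique in a blow-up of a
power of `G'`. Between unrelated cliques colour `b` is sparse, so one vertex can be picked greedily
from each clique so that the required pairs are edges avoiding `b`. Nothing is known about two
paths' vertices in the same set; these pairs form exactly the matchings removed by shearing, so
sheared blow-ups reproduce themselves.

The greedy choice needs the degrees of `G'` bounded independently of `n`. Sampling edges at random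
(`exists_sparsification`) achieves this, at the price of replacing `ρ` by `16 * ρ` and discarding at
most `n` vertices. -/

namespace SizeRamsey

open SimpleGraph

/-! ### Ramsey's theorem for coverings -/

/-- Ramsey's theorem for coverings of the pairs of a finite set by symmetric relations. -/
theorem exists_ramsey_bound {s : ℕ} (d : ℕ) : ∀ m : Fin s → ℕ, ∑ i, m i = d →
    ∃ N : ℕ, ∀ {α : Type} [DecidableEq α] (R : Fin s → α → α → Prop),
      (∀ i x y, R i x y → R i y x) → ∀ S : Finset α, N ≤ S.card →
      (∀ x ∈ S, ∀ y ∈ S, x ≠ y → ∃ i, R i x y) →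
      ∃ i, ∃ B ⊆ S, m i ≤ B.card ∧ ∀ x ∈ B, ∀ y ∈ B, x ≠ y → R i x y := by
  classical
  induction d with
  | zero =>
    intro m hm
    -- Two points are needed only to produce some index: `Fin s` may be empty.
    refine ⟨2, fun R _ S hS hR => ?_⟩
    obtain ⟨x, hx, y, hy, hxy⟩ := Finset.one_lt_card.1 hS
    obtain ⟨i, _⟩ := hR x hx y hy hxy
    have : m i = 0 := (Finset.sum_eq_zero_iff.1 hm) i (Finset.mem_univ i)
    exact ⟨i, ∅, by simp, by simp [this], by simp⟩
  | succ d ih =>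
    intro m hm
    by_cases h0 : ∃ i, m i = 0
    · obtain ⟨i, hi⟩ := h0
      exact ⟨0, fun R _ S _ _ => ⟨i, ∅, by simp, by simp [hi], by simp⟩⟩
    push Not at h0
    have key : ∀ j : Fin s, ∑ i, Function.update m j (m j - 1) i = d := by
      intro j
      rw [Finset.sum_update_of_mem (Finset.mem_univ j)]
      have := Finset.sum_sdiff (s₁ := {j}) (s₂ := Finset.univ) (f := m) (by simp)
      rw [Finset.sum_singleton] at this
      have := h0 j
      omega
    choose N hN using fun j => ih _ (key j)
    refine ⟨2 + ∑ j, N j, fun {α} _ R hsym S hS hR => ?_⟩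
    obtain ⟨x, hx⟩ : S.Nonempty := Finset.card_pos.1 (by omega)
    have hcov : S.erase x ⊆ Finset.univ.biUnion fun j => (S.erase x).filter (R j x) := by
      intro y hy
      obtain ⟨hne, hyS⟩ := Finset.mem_erase.1 hy
      obtain ⟨j, hj⟩ := hR x hx y hyS hne.symm
      simp only [Finset.mem_biUnion, Finset.mem_filter, Finset.mem_univ, true_and]
      exact ⟨j, hy, hj⟩
    obtain ⟨j, hj⟩ : ∃ j, N j ≤ ((S.erase x).filter (R j x)).card := by
      by_contra! hcon
      have h1 := (Finset.card_le_card hcov).trans Finset.card_biUnion_le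
      have h2 : ∑ j, ((S.erase x).filter (R j x)).card ≤ ∑ j, N j :=
        Finset.sum_le_sum fun j _ => (hcon j).le
      rw [Finset.card_erase_of_mem hx] at h1
      omega
    obtain ⟨i, B, hB, hcard, hmono⟩ := hN j R hsym _ hj fun y hy z hz hyz =>
      hR y (Finset.mem_of_mem_erase (Finset.mem_filter.1 hy).1) z
        (Finset.mem_of_mem_erase (Finset.mem_filter.1 hz).1) hyz
    have hBS : B ⊆ S := fun y hy => Finset.mem_of_mem_erase (Finset.mem_filter.1 (hB hy)).1
    by_cases hij : i = j
    · subst hij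
      have hxB : x ∉ B := fun h => by simpa using hB h
      refine ⟨i, insert x B, Finset.insert_subset hx hBS, ?_, ?_⟩
      · rw [Finset.card_insert_of_notMem hxB]
        rw [Function.update_self] at hcard
        omega
      · have hxy : ∀ y ∈ B, R i x y := fun y hy => (Finset.mem_filter.1 (hB hy)).2
        intro y hy z hz hyz
        rcases Finset.mem_insert.1 hy with rfl | hyB <;> rcases Finset.mem_insert.1 hz with rfl | hzB
        · exact absurd rfl hyz
        · exact hxy z hzB
        · exact hsym _ _ _ (hxy y hyB)
        · exact hmono y hyB z hzB hyz
    · rw [Function.update_of_ne hij] at hcard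
      exact ⟨i, B, hBS, hcard, hmono⟩

/-! ### Long paths, or large unrelated sets -/

/-- Depth-first search: a symmetric relation on `U` contains a path on `n` vertices, or `U` contains
two large sets with no related pair between them. -/
theorem exists_path_or_split {V : Type*} [DecidableEq V] (rel : V → V → Prop)
    (hsymm : ∀ u v, rel u v → rel v u) (n m : ℕ) (U : Finset V) (hU : m + n ≤ U.card) :
    (∃ l : List V, l.length = n ∧ l.Nodup ∧ l.IsChain rel) ∨
      ∃ S ⊆ U, ∃ T ⊆ U, S.card = m ∧ U.card ≤ T.card + m + n ∧ Disjoint S T ∧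
        ∀ x ∈ S, ∀ y ∈ T, ¬ rel x y := by
  -- `S` holds the finished vertices, `T` the unvisited ones, `l` the stack. A vertex is finished
  -- only when it has no relation into `T`. Moving a vertex from `T` to `l`, or from `l` to `S`,
  -- lowers `2 * T.card + l.length` by one.
  have key : ∀ (N : ℕ) (S T : Finset V) (l : List V), 2 * T.card + l.length ≤ N →
      S ⊆ U → T ⊆ U → (∀ x ∈ l, x ∈ U) → S.card + T.card + l.length = U.card →
      Disjoint S T → (∀ x ∈ l, x ∉ S ∧ x ∉ T) → (∀ x ∈ S, ∀ y ∈ T, ¬ rel x y) →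
      S.card ≤ m → l.length ≤ n → l.Nodup → l.IsChain rel →
      (∃ l : List V, l.length = n ∧ l.Nodup ∧ l.IsChain rel) ∨
      ∃ S ⊆ U, ∃ T ⊆ U, S.card = m ∧ U.card ≤ T.card + m + n ∧ Disjoint S T ∧
        ∀ x ∈ S, ∀ y ∈ T, ¬ rel x y := by
    intro N
    induction N with
    | zero =>
      intro S T l hN hS hT hl hcard hd hld hrel hm hn hnd hch
      refine Or.inr ⟨S, hS, T, hT, ?_, ?_, hd, hrel⟩ <;> omega
    | succ N ih =>
      intro S T l hN hS hT hl hcard hd hld hrel hm hn hnd hch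
      rcases hn.eq_or_lt with hn | hn
      · exact Or.inl ⟨l, hn, hnd, hch⟩
      rcases hm.eq_or_lt with hm | hm
      · exact Or.inr ⟨S, hS, T, hT, hm, by omega, hd, hrel⟩
      have push : ∀ y ∈ T, (y :: l).IsChain rel →
          (∃ l : List V, l.length = n ∧ l.Nodup ∧ l.IsChain rel) ∨
          ∃ S ⊆ U, ∃ T ⊆ U, S.card = m ∧ U.card ≤ T.card + m + n ∧ Disjoint S T ∧
          ∀ x ∈ S, ∀ y ∈ T, ¬ rel x y := by
        intro y hy hyl
        have hpos : 0 < T.card := Finset.card_pos.2 ⟨y, hy⟩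
        have hc := Finset.card_erase_of_mem hy
        refine ih S (T.erase y) (y :: l) ?_ hS ((Finset.erase_subset _ _).trans hT) ?_ ?_ ?_ ?_ ?_
          hm.le ?_ ?_ hyl
        · simp only [List.length_cons]; omega
        · simpa using ⟨hT hy, hl⟩
        · simp only [List.length_cons]; omega
        · exact hd.mono_right (Finset.erase_subset _ _)
        · intro x hx
          rcases List.mem_cons.1 hx with rfl | hx
          · exact ⟨Finset.disjoint_right.1 hd hy, by simp⟩
          · exact ⟨(hld x hx).1, fun h => (hld x hx).2 (Finset.mem_of_mem_erase h)⟩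
        · exact fun x hx z hz => hrel x hx z (Finset.mem_of_mem_erase hz)
        · simp only [List.length_cons]; omega
        · exact List.nodup_cons.2 ⟨fun h => (hld y h).2 hy, hnd⟩
      cases l with
      | nil =>
        obtain ⟨y, hy⟩ : T.Nonempty := Finset.card_pos.1 (by
          simp only [List.length_nil] at hcard hn; omega)
        exact push y hy (by simp)
      | cons v l =>
        by_cases hv : ∃ y ∈ T, rel v y
        · obtain ⟨y, hy, hvy⟩ := hv
          exact push y hy (List.isChain_cons_cons.2 ⟨hsymm _ _ hvy, hch⟩)
        · push Not at hv
          have hvl := hld v (by simp)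
          have hc := Finset.card_insert_of_notMem hvl.1
          simp only [List.length_cons] at hN hcard hn
          refine ih (insert v S) T l (by omega) (Finset.insert_subset (hl v (by simp)) hS) hT
            (fun x hx => hl x (by simp [hx])) (by omega) ?_ ?_ ?_ (by omega) (by omega)
            (List.nodup_cons.1 hnd).2 hch.tail
          · exact Finset.disjoint_insert_left.2 ⟨hvl.2, hd⟩
          · intro x hx
            refine ⟨fun h => ?_, (hld x (by simp [hx])).2⟩
            rcases Finset.mem_insert.1 h with rfl | h
            · exact (List.nodup_cons.1 hnd).1 hx
            · exact (hld x (by simp [hx])).1 h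
          · intro x hx y hy
            rcases Finset.mem_insert.1 hx with rfl | hx
            · exact hv y hy
            · exact hrel x hx y hy
  exact key _ ∅ U [] le_rfl (by simp) (by simp) (by simp) (by simp) (by simp) (by simp) (by simp)
    (by simp) (by simp) (by simp) (by simp)

/-- A symmetric relation without a path on `n` vertices has many large mutually unrelated sets. -/
theorem exists_path_or_parts {V : Type*} [DecidableEq V] (rel : V → V → Prop)
    (hsymm : ∀ u v, rel u v → rel v u) (n m : ℕ) (ℓ : ℕ) : ∀ U : Finset V, ℓ * (m + n) ≤ U.card →
    (∃ l : List V, l.length = n ∧ l.Nodup ∧ l.IsChain rel) ∨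
      ∃ A : ℕ → Finset V, (∀ i < ℓ, A i ⊆ U ∧ (A i).card = m) ∧
        ∀ i < ℓ, ∀ j < ℓ, i ≠ j → Disjoint (A i) (A j) ∧ ∀ x ∈ A i, ∀ y ∈ A j, ¬ rel x y := by
  induction ℓ with
  | zero => exact fun U _ => Or.inr ⟨fun _ => ∅, by simp, by simp⟩
  | succ ℓ ih =>
    intro U hU
    rw [Nat.succ_mul] at hU
    rcases exists_path_or_split rel hsymm n m U (by omega) with h | ⟨S, hS, T, hT, hSc, hTc, hd, hST⟩
    · exact Or.inl h
    rcases ih T (by omega) with h | ⟨A, hA, hAA⟩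
    · exact Or.inl h
    refine Or.inr ⟨fun i => Nat.casesOn i S A, ?_, ?_⟩
    · rintro (_ | i) hi
      · exact ⟨hS, hSc⟩
      · exact ⟨(hA i (by omega)).1.trans hT, (hA i (by omega)).2⟩
    · rintro (_ | i) hi (_ | j) hj hij
      · exact absurd rfl hij
      · have hs := (hA j (by omega)).1
        exact ⟨hd.mono_right hs, fun x hx y hy => hST x hx y (hs hy)⟩
      · have hs := (hA i (by omega)).1
        exact ⟨(hd.mono_right hs).symm, fun x hx y hy h => hST y hy x (hs hx) (hsymm _ _ h)⟩
      · exact hAA i (by omega) j (by omega) (by omega)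

/-! ### Disjoint transversal paths -/

/-- If any two disjoint `n`-sets span an edge, then some vertex of every `n`-subset of `A 0` starts a
path running through `A 0, A 1, …, A ℓ`. -/
theorem exists_transversal_path {V : Type*} [DecidableEq V] (G : SimpleGraph V) (n : ℕ) (hn : 0 < n)
    (hG : ∀ X Y : Finset V, Disjoint X Y → X.card = n → Y.card = n →
      ∃ x ∈ X, ∃ y ∈ Y, G.Adj x y) (ℓ : ℕ) : ∀ A : ℕ → Finset V,
    (∀ i < ℓ, Disjoint (A i) (A (i + 1))) → (∀ i ≤ ℓ, 2 * n ≤ (A i).card) →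
    ∀ X ⊆ A 0, X.card = n → ∃ p : ℕ → V, p 0 ∈ X ∧ (∀ i ≤ ℓ, p i ∈ A i) ∧
      ∀ i < ℓ, G.Adj (p i) (p (i + 1)) := by
  classical
  induction ℓ with
  | zero =>
    intro A _ _ X hX hXc
    obtain ⟨x, hx⟩ : X.Nonempty := Finset.card_pos.1 (by omega)
    exact ⟨fun _ => x, hx, fun i hi => by obtain rfl : i = 0 := by omega
                                          exact hX hx, by simp⟩
  | succ ℓ ih =>
    intro A hd hA X hX hXc
    -- Fewer than `n` vertices of `A 1` fail to start a path through the later sets, since `n`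
    -- failures would contradict the induction hypothesis. Hence at least `n` succeed, and `X` sends
    -- an edge to them.
    set S := (A 1).filter fun v => ∃ p : ℕ → V, p 0 = v ∧ (∀ i ≤ ℓ, p i ∈ A (i + 1)) ∧
      ∀ i < ℓ, G.Adj (p i) (p (i + 1)) with hS
    have hc : n ≤ S.card := by
      by_contra! hlt
      have h1 : n ≤ (A 1 \ S).card := by
        have := Finset.le_card_sdiff S (A 1)
        have := hA 1 (by omega)
        omega
      obtain ⟨Y, hY, hYc⟩ := Finset.exists_subset_card_eq h1
      obtain ⟨p, hp0, hp, hadj⟩ := ih (fun i => A (i + 1)) (fun i hi => hd (i + 1) (by omega))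
        (fun i hi => hA (i + 1) (by omega)) Y (hY.trans Finset.sdiff_subset) hYc
      have h2 := Finset.mem_sdiff.1 (hY hp0)
      exact h2.2 (Finset.mem_filter.2 ⟨h2.1, p, rfl, hp, hadj⟩)
    obtain ⟨Y, hY, hYc⟩ := Finset.exists_subset_card_eq hc
    have hYA : Y ⊆ A 1 := hY.trans (Finset.filter_subset _ _)
    obtain ⟨x, hx, y, hy, hxy⟩ := hG X Y
      (Finset.disjoint_of_subset_left hX (Finset.disjoint_of_subset_right hYA (hd 0 (by omega))))
      hXc hYc
    obtain ⟨p, rfl, hp, hadj⟩ := (Finset.mem_filter.1 (hY hy)).2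
    refine ⟨fun i => Nat.casesOn i x p, hx, ?_, ?_⟩
    · rintro (_ | i) hi
      · exact hX hx
      · exact hp i (by omega)
    · rintro (_ | i) hi
      · exact hxy
      · exact hadj i (by omega)

/-- Many disjoint paths running through `A 0, A 1, …, A ℓ`. -/
theorem exists_disjoint_transversal_paths {V : Type*} [DecidableEq V] (G : SimpleGraph V)
    (n : ℕ) (hn : 0 < n)
    (hG : ∀ X Y : Finset V, Disjoint X Y → X.card = n → Y.card = n →
      ∃ x ∈ X, ∃ y ∈ Y, G.Adj x y) (ℓ N : ℕ) : ∀ A : ℕ → Finset V,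
    (∀ i < ℓ, Disjoint (A i) (A (i + 1))) → (∀ i ≤ ℓ, N + 2 * n ≤ (A i).card) →
    ∃ p : ℕ → ℕ → V, (∀ m < N, ∀ i ≤ ℓ, p m i ∈ A i) ∧
      (∀ m < N, ∀ i < ℓ, G.Adj (p m i) (p m (i + 1))) ∧
      ∀ m < N, ∀ m' < N, ∀ i ≤ ℓ, p m i = p m' i → m = m' := by
  induction N with
  | zero =>
    intro A _ hA
    obtain ⟨x, _⟩ : (A 0).Nonempty := Finset.card_pos.1 (by have := hA 0 (by omega); omega)
    exact ⟨fun _ _ => x, by simp, by simp, by simp⟩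
  | succ N ih =>
    intro A hd hA
    obtain ⟨X, hX, hXc⟩ := Finset.exists_subset_card_eq
      (show n ≤ (A 0).card by have := hA 0 (by omega); omega)
    obtain ⟨q, -, hq, hqadj⟩ := exists_transversal_path G n hn hG ℓ A hd
      (fun i hi => by have := hA i hi; omega) X hX hXc
    obtain ⟨p, hp, hadj, hinj⟩ := ih (fun i => (A i).erase (q i))
      (fun i hi => Finset.disjoint_of_subset_left (Finset.erase_subset _ _)
        (Finset.disjoint_of_subset_right (Finset.erase_subset _ _) (hd i hi)))
      (fun i hi => by
        have := hA i hi
        rw [Finset.card_erase_of_mem (hq i hi)]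
        omega)
    have hne : ∀ m < N, ∀ i ≤ ℓ, p m i ≠ q i := fun m hm i hi =>
      (Finset.mem_erase.1 (hp m hm i hi)).1
    refine ⟨fun m => Nat.casesOn m q p, ?_, ?_, ?_⟩
    · rintro (_ | m) hm i hi
      · exact hq i hi
      · exact Finset.mem_of_mem_erase (hp m (by omega) i hi)
    · rintro (_ | m) hm i hi
      · exact hqadj i hi
      · exact hadj m (by omega) i hi
    · rintro (_ | m) hm (_ | m') hm' i hi h
      · rfl
      · exact absurd h.symm (hne m' (by omega) i hi)
      · exact absurd h (hne m (by omega) i hi)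
      · rw [hinj m (by omega) m' (by omega) i hi h]

/-! ### Greedy transversals and bounded degree -/

/-- Greedy choice of a transversal avoiding a sparse relation `bad`: between the candidate sets of
adjacent indices there is no complete bad pair of sizes `q` and `2 * q`. -/
theorem exists_good_transversal {ι β : Type*} [Fintype ι] [DecidableEq ι] [DecidableEq β]
    (adj : ι → ι → Prop) (hirr : ∀ v, ¬ adj v v) (hsymm : ∀ v w, adj v w → adj w v)
    (q Δ : ℕ) (hq : 0 < q) (nb : ι → Finset ι) (hnb : ∀ v w, adj v w → w ∈ nb v)
    (hΔ : ∀ v, (nb v).card ≤ Δ) (bad : β → β → Prop) (hbad : ∀ x y, bad x y → bad y x)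
    (B : ι → Finset β) (hB : ∀ v, (2 * q) ^ Δ * (Δ * q + 4 * q) ≤ (B v).card)
    (h : ∀ v w, adj v w → ∀ X ⊆ B v, ∀ Y ⊆ B w, X.card = q → Y.card = 2 * q →
      ∃ x ∈ X, ∃ y ∈ Y, ¬ bad x y) :
    ∃ x : ι → β, (∀ v, x v ∈ B v) ∧ ∀ v w, adj v w → ¬ bad (x v) (x w) := by
  classical
  -- `P` is the set of indices already treated and `C w` the candidates still compatible with them;
  -- each treated neighbour of `w` shrinks `C w` by a factor of at most `2 * q`.
  have key : ∀ P : Finset ι, ∃ (x : ι → β) (C : ι → Finset β), (∀ v, C v ⊆ B v) ∧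
      (∀ v ∈ P, x v ∈ B v) ∧ (∀ v ∈ P, ∀ w ∈ P, adj v w → ¬ bad (x v) (x w)) ∧
      (∀ v ∈ P, ∀ w ∉ P, adj v w → ∀ y ∈ C w, ¬ bad (x v) y) ∧
      ∀ w ∉ P, (B w).card ≤ (C w).card * (2 * q) ^ (P.filter fun v => adj v w).card := by
    intro P
    induction P using Finset.induction_on with
    | empty =>
      have hne : ∀ v, (B v).Nonempty := fun v => Finset.card_pos.1
        (lt_of_lt_of_le (by positivity) (hB v))
      exact ⟨fun v => (hne v).choose, B, fun _ => subset_rfl, by simp, by simp, by simp, by simp⟩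
    | insert v P hv ih =>
      obtain ⟨x, C, hCB, hxB, hPP, hPC, hcard⟩ := ih
      have hbig : ∀ w ∉ P, Δ * q + 4 * q ≤ (C w).card := by
        intro w hw
        have h1 := hcard w hw
        have h2 : (P.filter fun v => adj v w).card ≤ Δ :=
          (Finset.card_le_card fun u hu => hnb w u (hsymm _ _ (Finset.mem_filter.1 hu).2)).trans
            (hΔ w)
        have h3 : (2 * q) ^ (P.filter fun v => adj v w).card ≤ (2 * q) ^ Δ :=
          Nat.pow_le_pow_right (by omega) h2
        have h4 : (2 * q) ^ Δ * (Δ * q + 4 * q) ≤ (2 * q) ^ Δ * (C w).card := by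
          rw [mul_comm _ (C w).card]
          exact (hB w).trans (h1.trans (Nat.mul_le_mul_left _ h3))
        exact Nat.le_of_mul_le_mul_left h4 (by positivity)
      -- If every `z` spoils some neighbour, then more than `Δ * q` candidates force `q` of them to
      -- spoil the same `w`. Together they have non-bad partners on at most half of `C w`, so at
      -- least `2 * q` elements are bad to all of them, against `h`.
      obtain ⟨z, hz, hzw⟩ : ∃ z ∈ C v, ∀ w ∉ P, adj v w →
          (C w).card ≤ 2 * q * ((C w).filter fun y => ¬ bad z y).card := by
        by_contra! hcon
        have : Nonempty ι := ⟨v⟩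
        choose! g hgP hg hgc using hcon
        obtain ⟨w, -, hw⟩ := Finset.exists_lt_card_fiber_of_mul_lt_card_of_maps_to
          (s := C v) (t := nb v) (f := g) (n := q) (fun z hz => hnb v _ (hg z hz)) (by
            have h1 := hbig v hv
            have h2 := Nat.mul_le_mul_right q (hΔ v)
            omega)
        obtain ⟨X, hX, hXc⟩ := Finset.exists_subset_card_eq hw.le
        have hXm : ∀ z ∈ X, z ∈ C v ∧ g z = w := fun z hz => Finset.mem_filter.1 (hX hz)
        obtain ⟨z0, hz0⟩ : X.Nonempty := Finset.card_pos.1 (by omega)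
        have hwP : w ∉ P := (hXm z0 hz0).2 ▸ hgP z0 (hXm z0 hz0).1
        have hvw : adj v w := (hXm z0 hz0).2 ▸ hg z0 (hXm z0 hz0).1
        have hY : 2 * q ≤ ((C w).filter fun y => ∀ z ∈ X, bad z y).card := by
          have hsub : C w ⊆ ((C w).filter fun y => ∀ z ∈ X, bad z y) ∪
              X.biUnion fun z => (C w).filter fun y => ¬ bad z y := by
            intro y hy
            by_cases hyX : ∀ z ∈ X, bad z y
            · exact Finset.mem_union_left _ (Finset.mem_filter.2 ⟨hy, hyX⟩)
            · push Not at hyX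
              obtain ⟨z, hz, hzy⟩ := hyX
              exact Finset.mem_union_right _
                (Finset.mem_biUnion.2 ⟨z, hz, Finset.mem_filter.2 ⟨hy, hzy⟩⟩)
          have h1 := (Finset.card_le_card hsub).trans (Finset.card_union_le _ _)
          have h2 : 2 * q * (X.biUnion fun z => (C w).filter fun y => ¬ bad z y).card ≤
              q * (C w).card := by
            calc _ ≤ 2 * q * ∑ z ∈ X, ((C w).filter fun y => ¬ bad z y).card :=
                  Nat.mul_le_mul_left _ Finset.card_biUnion_le
              _ = ∑ z ∈ X, 2 * q * ((C w).filter fun y => ¬ bad z y).card := Finset.mul_sum _ _ _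
              _ ≤ ∑ z ∈ X, (C w).card := Finset.sum_le_sum fun z hz => by
                  have := hgc z (hXm z hz).1
                  rw [(hXm z hz).2] at this
                  exact this.le
              _ = q * (C w).card := by rw [Finset.sum_const, hXc, smul_eq_mul]
          have h3 : 2 * (X.biUnion fun z => (C w).filter fun y => ¬ bad z y).card ≤
              (C w).card := Nat.le_of_mul_le_mul_left (by linarith) hq
          have h4 := hbig w hwP
          have h5 := Nat.zero_le (Δ * q)
          omega
        obtain ⟨Y, hYs, hYc⟩ := Finset.exists_subset_card_eq hY
        obtain ⟨z, hz, y, hy, hzy⟩ := h v w hvw X (fun z hz => hCB v (hXm z hz).1) Y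
          (fun y hy => hCB w (Finset.mem_filter.1 (hYs hy)).1) hXc hYc
        exact hzy ((Finset.mem_filter.1 (hYs hy)).2 z hz)
      refine ⟨Function.update x v z,
        fun w => if adj v w then (C w).filter fun y => ¬ bad z y else C w, ?_, ?_, ?_, ?_, ?_⟩
      · intro w
        dsimp only
        split_ifs
        · exact (Finset.filter_subset _ _).trans (hCB w)
        · exact hCB w
      · intro u hu
        by_cases huv : u = v
        · subst huv
          rw [Function.update_self]
          exact hCB _ hz
        · rw [Function.update_of_ne huv]
          exact hxB u ((Finset.mem_insert.1 hu).resolve_left huv)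
      · intro u hu w hw huw
        by_cases huv : u = v <;> by_cases hwv : w = v
        · subst huv; subst hwv; exact absurd huw (hirr _)
        · subst huv
          rw [Function.update_self, Function.update_of_ne hwv]
          exact fun hb => hPC w ((Finset.mem_insert.1 hw).resolve_left hwv) u hv
            (hsymm _ _ huw) z hz (hbad _ _ hb)
        · subst hwv
          rw [Function.update_self, Function.update_of_ne huv]
          exact hPC u ((Finset.mem_insert.1 hu).resolve_left huv) w hv huw z hz
        · rw [Function.update_of_ne hwv, Function.update_of_ne huv]
          exact hPP u ((Finset.mem_insert.1 hu).resolve_left huv) w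
            ((Finset.mem_insert.1 hw).resolve_left hwv) huw
      · intro u hu w hw huw y hy
        have hwP : w ∉ P := fun hh => hw (Finset.mem_insert_of_mem hh)
        dsimp only at hy
        by_cases huv : u = v
        · subst huv
          rw [if_pos huw] at hy
          rw [Function.update_self]
          exact (Finset.mem_filter.1 hy).2
        · rw [Function.update_of_ne huv]
          refine hPC u ((Finset.mem_insert.1 hu).resolve_left huv) w hwP huw y ?_
          split_ifs at hy
          · exact (Finset.mem_filter.1 hy).1
          · exact hy
      · intro w hw
        have hwP : w ∉ P := fun hh => hw (Finset.mem_insert_of_mem hh)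
        rw [Finset.filter_insert]
        dsimp only
        split_ifs with hvw
        · rw [Finset.card_insert_of_notMem (fun hh => hv (Finset.mem_filter.1 hh).1), pow_succ]
          calc (B w).card ≤ (C w).card * (2 * q) ^ (P.filter fun v => adj v w).card := hcard w hwP
            _ ≤ (2 * q * ((C w).filter fun y => ¬ bad z y).card) *
                (2 * q) ^ (P.filter fun v => adj v w).card :=
              Nat.mul_le_mul_right _ (hzw w hwP hvw)
            _ = _ := by ring
        · exact hcard w hwP
  obtain ⟨x, -, -, hx, hxx, -, -⟩ := key Finset.univ
  exact ⟨x, fun v => hx v (Finset.mem_univ v),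
    fun v w hvw => hxx v (Finset.mem_univ v) w (Finset.mem_univ w) hvw⟩

/-- The set of vertices at distance at most `r` has bounded size in a graph of bounded degree. -/
theorem exists_ball_card_le {V : Type*} [DecidableEq V] (G : SimpleGraph V)
    (nb : V → Finset V) (hnb : ∀ v w, G.Adj v w → w ∈ nb v) (D : ℕ) (hD : ∀ v, (nb v).card ≤ D)
    (r : ℕ) (v : V) : ∃ S : Finset V, S.card ≤ (D + 1) ^ r ∧
      ∀ w, G.edist v w ≤ r → w ∈ S := by
  have key : ∀ r : ℕ, ∀ v : V, ∃ S : Finset V, S.card ≤ (D + 1) ^ r ∧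
      ∀ w, ∀ p : G.Walk v w, p.length ≤ r → w ∈ S := by
    intro r
    induction r with
    | zero =>
      refine fun v => ⟨{v}, by simp, fun w p hp => ?_⟩
      cases p with
      | nil => simp
      | cons _ _ => simp at hp
    | succ r ih =>
      intro v
      choose S hS hw using ih
      refine ⟨(insert v (nb v)).biUnion S, ?_, fun w p hp => ?_⟩
      · calc _ ≤ ∑ u ∈ insert v (nb v), (S u).card := Finset.card_biUnion_le
          _ ≤ ∑ u ∈ insert v (nb v), (D + 1) ^ r := Finset.sum_le_sum fun u _ => hS u
          _ = (insert v (nb v)).card * (D + 1) ^ r := by rw [Finset.sum_const, smul_eq_mul]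
          _ ≤ (D + 1) * (D + 1) ^ r := Nat.mul_le_mul_right _
              ((Finset.card_insert_le _ _).trans (by have := hD v; omega))
          _ = _ := by ring
      · cases p with
        | nil => exact Finset.mem_biUnion.2 ⟨v, by simp, hw v v .nil (by simp)⟩
        | cons hadj p =>
          rw [Walk.length_cons] at hp
          exact Finset.mem_biUnion.2 ⟨_, Finset.mem_insert_of_mem (hnb _ _ hadj),
            hw _ _ p (by omega)⟩
  obtain ⟨S, hS, hw⟩ := key r v
  refine ⟨S, hS, fun w h => ?_⟩
  obtain ⟨p, hp⟩ := (reachable_of_edist_ne_top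
    (ne_top_of_le_ne_top (ENat.natCast_ne_top r) h)).exists_walk_length_eq_edist
  exact hw w p (by rw [← hp] at h; exact_mod_cast h)

/-! ### Powers of paths from chains of cliques -/

/-- Vertices of a path at distance at most `k` have indices differing by at most `k`. -/
theorem le_add_of_graphPower_pathGraph {n k : ℕ} {i j : Fin n}
    (h : (graphPower (pathGraph n) k).Adj i j) : (j : ℕ) ≤ i + k := by
  obtain ⟨p, hp⟩ := (reachable_of_edist_ne_top
    (ne_top_of_le_ne_top (ENat.natCast_ne_top k) h.2)).exists_walk_length_eq_edist
  have h2 := h.2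
  rw [← hp] at h2
  have h3 : p.length ≤ k := by exact_mod_cast h2
  have key : ∀ (u v : Fin n) (p : (pathGraph n).Walk u v), (v : ℕ) ≤ u + p.length := by
    intro u v p
    induction p with
    | nil => simp
    | cons hadj p ih =>
      rw [pathGraph_adj] at hadj
      rw [Walk.length_cons]
      omega
  have := key i j p
  omega

/-- A sequence of disjoint `k`-cliques with consecutive ones completely joined contains the `k`-th
power of a path. -/
theorem graphPower_pathGraph_isContained_of_blocks {β : Type*} (R : SimpleGraph β) (n k : ℕ)
    (hk : 0 < k) (Z : ℕ → Finset β) (hc : ∀ b < n, (Z b).card = k)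
    (hZ : ∀ b < n, ∀ x ∈ Z b, ∀ y ∈ Z b, x ≠ y → R.Adj x y)
    (hZZ : ∀ b, b + 1 < n → ∀ x ∈ Z b, ∀ y ∈ Z (b + 1), R.Adj x y)
    (hd : ∀ b < n, ∀ b' < n, b ≠ b' → Disjoint (Z b) (Z b')) :
    (graphPower (pathGraph n) k).IsContained R := by
  have hlt : ∀ i : Fin n, (i : ℕ) / k < n := fun i => (Nat.div_le_self _ _).trans_lt i.2
  -- Indices differing by at most `k` lie in equal or consecutive blocks of length `k`.
  let f : Fin n → β := fun i =>
    ((Z (i / k)).equivFinOfCardEq (hc _ (hlt i))).symm ⟨i % k, Nat.mod_lt _ hk⟩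
  have hf : ∀ i : Fin n, f i ∈ Z (i / k) := fun i => Finset.coe_mem _
  have hinj : Function.Injective f := by
    intro i j hij
    by_cases hb : (i : ℕ) / k = j / k
    · have key : ∀ (b b' : ℕ) (hb : b < n) (hb' : b' < n) (x y : Fin k), b = b' →
          (((Z b).equivFinOfCardEq (hc _ hb)).symm x : β) =
            ((Z b').equivFinOfCardEq (hc _ hb')).symm y → x = y := by
        rintro b _ hb hb' x y rfl hxy
        exact ((Z b).equivFinOfCardEq (hc _ hb)).symm.injective (Subtype.ext hxy)
      have h1 := congrArg Fin.val (key _ _ (hlt i) (hlt j) _ _ hb hij)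
      dsimp only at h1
      refine Fin.ext ?_
      rw [← Nat.div_add_mod (i : ℕ) k, ← Nat.div_add_mod (j : ℕ) k, hb, h1]
    · exact absurd hij (Finset.disjoint_iff_ne.1 (hd _ (hlt i) _ (hlt j) hb) _ (hf i) _ (hf j))
  have hadj : ∀ i j : Fin n, i < j → (j : ℕ) ≤ i + k → R.Adj (f i) (f j) := by
    intro i j hij hjk
    have h1 : (i : ℕ) / k ≤ j / k := Nat.div_le_div_right hij.le
    have h2 : (j : ℕ) / k ≤ i / k + 1 := by
      rw [← Nat.add_div_right _ hk]
      exact Nat.div_le_div_right hjk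
    rcases h1.eq_or_lt with h | h
    · exact hZ _ (hlt i) _ (hf i) _ (h ▸ hf j) fun hh => hij.ne (hinj hh)
    · have h3 : (j : ℕ) / k = i / k + 1 := by omega
      exact hZZ _ (h3 ▸ hlt j) _ (hf i) _ (h3 ▸ hf j)
  refine ⟨⟨⟨f, fun {i j} hij => ?_⟩, hinj⟩⟩
  rcases lt_or_gt_of_ne hij.1 with h | h
  · exact hadj i j h (le_add_of_graphPower_pathGraph hij)
  · exact (hadj j i h (le_add_of_graphPower_pathGraph hij.symm)).symm

/-- Disjoint cliques `B v` along a path, consecutive ones containing a complete pair of size `2 * k`,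
contain the `k`-th power of a path. -/
theorem graphPower_pathGraph_isContained_of_cliques {V β : Type*} [DecidableEq β]
    (R : SimpleGraph β) (n k : ℕ) (hk : 0 < k) (B : V → Finset β)
    (hB : ∀ v, ∀ x ∈ B v, ∀ y ∈ B v, x ≠ y → R.Adj x y)
    (hd : ∀ u v, u ≠ v → Disjoint (B u) (B v)) (l : List V) (hl : l.length = n + 2)
    (hnd : l.Nodup) (hch : l.IsChain fun u v => ∃ X ⊆ B u, ∃ Y ⊆ B v, X.card = 2 * k ∧
      Y.card = 2 * k ∧ ∀ x ∈ X, ∀ y ∈ Y, R.Adj x y) :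
    (graphPower (pathGraph n) k).IsContained R := by
  rw [List.isChain_iff_getElem] at hch
  have hch' : ∀ i : ℕ, ∃ X Y : Finset β, ∀ h : i + 1 < l.length, X ⊆ B l[i] ∧ Y ⊆ B l[i + 1] ∧
      X.card = 2 * k ∧ Y.card = 2 * k ∧ ∀ x ∈ X, ∀ y ∈ Y, R.Adj x y := by
    intro i
    by_cases h : i + 1 < l.length
    · obtain ⟨X, hX, Y, hY, h'⟩ := hch i h
      exact ⟨X, Y, fun _ => ⟨hX, hY, h'⟩⟩
    · exact ⟨∅, ∅, fun h' => absurd h' h⟩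
  choose X Y hXY using hch'
  have hX' : ∀ i : ℕ, ∃ X' ⊆ X (i + 1), i + 2 < l.length → X'.card = k := by
    intro i
    by_cases h : i + 2 < l.length
    · obtain ⟨X', h1, h2⟩ := Finset.exists_subset_card_eq
        (show k ≤ (X (i + 1)).card by rw [(hXY (i + 1) h).2.2.1]; omega)
      exact ⟨X', h1, fun _ => h2⟩
    · exact ⟨∅, by simp, fun h' => absurd h' h⟩
  choose X' hX' hXc using hX'
  -- Inside the clique of `l[i + 1]`, `Y' i` is the entry block and `X' i` the exit block. Size `2 *
  -- k` leaves room for both to be disjoint.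
  have hY' : ∀ i : ℕ, ∃ Y' ⊆ Y i \ X' i, i + 2 < l.length → Y'.card = k := by
    intro i
    by_cases h : i + 2 < l.length
    · obtain ⟨Y', h1, h2⟩ := Finset.exists_subset_card_eq
        (show k ≤ (Y i \ X' i).card by
          have h1 := Finset.le_card_sdiff (X' i) (Y i)
          rw [(hXY i (by omega)).2.2.2.1, hXc i h] at h1
          omega)
      exact ⟨Y', h1, fun _ => h2⟩
    · exact ⟨∅, by simp, fun h' => absurd h' h⟩
  choose Y' hY' hYc using hY'
  -- An even block and the next odd one are joined inside a common clique, an odd block and the next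
  -- even one by a complete pair.
  let Z : ℕ → Finset β := fun b => if b % 2 = 0 then Y' (b / 2) else X' (b / 2)
  have hZB : ∀ b (h : b < n), Z b ⊆ B (l[b / 2 + 1]'(by omega)) := by
    intro b h
    dsimp only [Z]
    split_ifs
    · exact (hY' _).trans (Finset.sdiff_subset.trans (hXY (b / 2) (by omega)).2.1)
    · exact (hX' _).trans (hXY (b / 2 + 1) (by omega)).1
  refine graphPower_pathGraph_isContained_of_blocks R n k hk Z ?_ ?_ ?_ ?_
  · intro b hb
    dsimp only [Z]
    split_ifs
    · exact hYc _ (by omega)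
    · exact hXc _ (by omega)
  · exact fun b hb x hx y hy => hB _ x (hZB b hb hx) y (hZB b hb hy)
  · intro b hb x hx y hy
    rcases Nat.mod_two_eq_zero_or_one b with h | h
    · have h1 : (b + 1) / 2 = b / 2 := by omega
      have h2 : (b + 1) % 2 ≠ 0 := by omega
      have hy' := hZB _ hb hy
      have hx' := hZB b (by omega) hx
      simp only [h1] at hy'
      refine hB _ x hx' y hy' ?_
      simp only [Z, h, if_true, h2, if_false, h1] at hx hy
      rintro rfl
      exact (Finset.mem_sdiff.1 (hY' _ hx)).2 hy
    · have h1 : (b + 1) / 2 = b / 2 + 1 := by omega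
      have h2 : (b + 1) % 2 = 0 := by omega
      have h3 : b % 2 ≠ 0 := by omega
      simp only [Z, h2, if_true, h3, if_false, h1] at hx hy
      exact (hXY (b / 2 + 1) (by omega)).2.2.2.2 x (hX' _ hx) y
        (Finset.mem_sdiff.1 (hY' _ hy)).1
  · intro b hb b' hb' hbb
    by_cases h : b / 2 = b' / 2
    · rcases Nat.mod_two_eq_zero_or_one b with h0 | h0
      · have h1 : b' % 2 ≠ 0 := by omega
        simp only [Z, h0, if_true, h1, if_false, h]
        exact Finset.disjoint_of_subset_left (hY' _) Finset.sdiff_disjoint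
      · have h1 : b' % 2 = 0 := by omega
        have h2 : b % 2 ≠ 0 := by omega
        simp only [Z, h2, if_true, h1, if_false, h]
        exact (Finset.disjoint_of_subset_left (hY' _) Finset.sdiff_disjoint).symm
    · refine Finset.disjoint_of_subset_left (hZB b hb)
        (Finset.disjoint_of_subset_right (hZB b' hb') (hd _ _ fun hh => h ?_))
      have := (List.Nodup.getElem_inj_iff hnd).1 hh
      omega

/-! ### Random sparsification of weights -/

/-- The total weight on a set of `a * n` points, when all pairs of `n`-sets carry bounded weight. -/
theorem sum_weight_le {I : Type*} [Fintype I] [DecidableEq I] (a n : ℕ)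
    (hI : Fintype.card I = a * n) (w : I → I → ℝ) (ρ : ℝ)
    (hw : ∀ X Y : Finset I, X.card = n → Y.card = n → ∑ x ∈ X, ∑ y ∈ Y, w x y ≤ ρ) :
    ∑ x, ∑ y, w x y ≤ a ^ 2 * ρ := by
  -- This splits `I` into `a` blocks of size `n`. Equal blocks are covered too, because `hw` does
  -- not ask for disjointness.
  let e : Fin a × Fin n ≃ I := Fintype.equivOfCardEq (by simp [hI])
  have hsum : ∀ g : I → ℝ, ∑ x, g x = ∑ i, ∑ j, g (e (i, j)) := fun g => by
    rw [← e.sum_comp, Fintype.sum_prod_type]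
  let X : Fin a → Finset I := fun i => Finset.univ.image fun j => e (i, j)
  have hinj : ∀ i, Function.Injective fun j => e (i, j) := fun i j j' h => by simpa using h
  have hX : ∀ i, (X i).card = n := fun i => by
    rw [Finset.card_image_of_injective _ (hinj i), Finset.card_univ, Fintype.card_fin]
  have hXs : ∀ i (g : I → ℝ), ∑ x ∈ X i, g x = ∑ j, g (e (i, j)) := fun i g =>
    Finset.sum_image fun _ _ _ _ h => hinj i h
  calc ∑ x, ∑ y, w x y = ∑ i, ∑ j, ∑ i', ∑ j', w (e (i, j)) (e (i', j')) := by
        rw [hsum]; simp only [hsum]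
    _ = ∑ i, ∑ i', ∑ x ∈ X i, ∑ y ∈ X i', w x y := by
        simp only [hXs]
        exact Finset.sum_congr rfl fun i _ => Finset.sum_comm
    _ ≤ ∑ i : Fin a, ∑ i' : Fin a, ρ := Finset.sum_le_sum fun i _ => Finset.sum_le_sum fun i' _ =>
        hw _ _ (hX i) (hX i')
    _ = a ^ 2 * ρ := by simp; ring

/-- A random sample of `M` points of a finite weighted set hits every set of a small family
about as often as expected. -/
theorem exists_sample {P F : Type*} [Fintype P] [DecidableEq P] (w : P → ℝ) (hw : ∀ p, 0 ≤ w p)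
    (W : ℝ) (hW : ∑ p, w p = W) (hW0 : 0 < W) (𝓕 : Finset F) (S : F → Finset P) (ρ : ℝ)
    (hρ : 1 ≤ ρ) (hS : ∀ X ∈ 𝓕, 1 ≤ ∑ p ∈ S X, w p ∧ ∑ p ∈ S X, w p ≤ ρ) (M : ℕ)
    (hM : (𝓕.card : ℝ) * (2 * Real.exp (-(M / W / 4))) < 1) :
    ∃ f : Fin M → P, (∀ i, w (f i) ≠ 0) ∧ ∀ X ∈ 𝓕, M / W / 4 ≤ ((Finset.univ.filter fun i => f i ∈ S X).card : ℝ) ∧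
      ((Finset.univ.filter fun i => f i ∈ S X).card : ℝ) ≤ 4 * ρ * (M / W) := by
  by_contra! hcon
  set μ : ℝ := M / W with hμ
  have hμ0 : 0 ≤ μ := by positivity
  let h : (Fin M → P) → F → ℝ := fun f X => ((Finset.univ.filter fun i => f i ∈ S X).card : ℝ)
  have hexp : ∀ (c : ℝ) (f : Fin M → P) (X : F),
      Real.exp (c * h f X) = ∏ i, if f i ∈ S X then Real.exp c else 1 := by
    intro c f X
    rw [Finset.prod_ite, Finset.prod_const, Finset.prod_const_one, mul_one, ← Real.exp_nat_mul,
      mul_comm]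
  -- Up to the factor `W ^ M`, this is the exponential moment of the number of hits when `M` points
  -- are drawn independently with probabilities `w p / W`.
  have hmoment : ∀ (c : ℝ) (X : F), ∑ f : Fin M → P, (∏ i, w (f i)) * Real.exp (c * h f X) =
      (W + (Real.exp c - 1) * ∑ p ∈ S X, w p) ^ M := by
    intro c X
    have h1 : W + (Real.exp c - 1) * ∑ p ∈ S X, w p =
        ∑ p, w p * if p ∈ S X then Real.exp c else 1 := by
      rw [← hW, Finset.mul_sum,
        ← Finset.sum_filter_add_sum_filter_not (s := Finset.univ) (p := (· ∈ S X)) (f := w)]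
      rw [← Finset.sum_filter_add_sum_filter_not (s := Finset.univ) (p := (· ∈ S X))
        (f := fun p => w p * if p ∈ S X then Real.exp c else 1)]
      have h2 : Finset.univ.filter (· ∈ S X) = S X := by ext; simp
      rw [h2, add_right_comm, ← Finset.sum_add_distrib]
      congr 1
      · exact Finset.sum_congr rfl fun p hp => by rw [if_pos hp]; ring
      · exact Finset.sum_congr rfl fun p hp => by
          rw [if_neg (Finset.mem_filter.1 hp).2, mul_one]
    rw [h1, Fintype.sum_pow]
    refine Finset.sum_congr rfl fun f _ => ?_
    rw [hexp, Finset.prod_mul_distrib]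
  -- Markov's inequality and the union bound in one line: a sample missing its target on some `X`
  -- makes one of the two exponentials at least `1`.
  have hone : ∀ f : Fin M → P, (∀ i, w (f i) ≠ 0) → 1 ≤ ∑ X ∈ 𝓕, (Real.exp (μ / 4) * Real.exp (-1 * h f X) +
      Real.exp (-(4 * ρ * μ)) * Real.exp (1 * h f X)) := by
    intro f hf
    obtain ⟨X, hX, hXf⟩ := hcon f hf
    refine le_trans ?_ (Finset.single_le_sum (f := fun X => Real.exp (μ / 4) *
      Real.exp (-1 * h f X) + Real.exp (-(4 * ρ * μ)) * Real.exp (1 * h f X))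
      (fun X _ => by positivity) hX)
    rw [← Real.exp_add, ← Real.exp_add]
    by_cases hlt : μ / 4 ≤ h f X
    · have h1 := hXf hlt
      have h2 : 1 ≤ Real.exp (-(4 * ρ * μ) + 1 * h f X) := Real.one_le_exp (by
        change 4 * ρ * μ < h f X at h1
        linarith)
      have := Real.exp_pos (μ / 4 + -1 * h f X)
      linarith
    · have h2 : 1 ≤ Real.exp (μ / 4 + -1 * h f X) := Real.one_le_exp (by linarith)
      have := Real.exp_pos (-(4 * ρ * μ) + 1 * h f X)
      linarith
  have hWM : 0 < W ^ M := by positivity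
  have hpow : ∀ z : ℝ, 0 ≤ W + z → (W + z) ^ M ≤ W ^ M * Real.exp (μ * z) := by
    intro z hz
    have h1 : W + z ≤ W * Real.exp (z / W) := by
      have := Real.add_one_le_exp (z / W)
      calc W + z = W * (z / W + 1) := by field_simp; ring
        _ ≤ _ := by gcongr
    calc (W + z) ^ M ≤ (W * Real.exp (z / W)) ^ M := by gcongr
      _ = W ^ M * Real.exp (μ * z) := by
        rw [mul_pow, ← Real.exp_nat_mul]
        congr 2
        rw [hμ]; ring
  have hterm : ∀ X ∈ 𝓕, Real.exp (μ / 4) * (W + (Real.exp (-1) - 1) * ∑ p ∈ S X, w p) ^ M +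
      Real.exp (-(4 * ρ * μ)) * (W + (Real.exp 1 - 1) * ∑ p ∈ S X, w p) ^ M ≤
      W ^ M * (2 * Real.exp (-(μ / 4))) := by
    intro X hX
    obtain ⟨hs1, hs2⟩ := hS X hX
    set σ := ∑ p ∈ S X, w p with hσ
    have hσW : σ ≤ W := by
      rw [← hW]
      exact Finset.sum_le_sum_of_subset_of_nonneg (Finset.subset_univ _) fun p _ _ => hw p
    have he1 : Real.exp (-1) ≤ 1 / 2 := by
      rw [Real.exp_neg, inv_eq_one_div]
      have := Real.add_one_le_exp 1
      exact one_div_le_one_div_of_le (by norm_num) (by linarith)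
    have he2 : Real.exp 1 ≤ 3 := by have := Real.exp_one_lt_d9; linarith
    have he3 := Real.exp_pos (-1)
    have hσ0 : 0 < σ := by linarith
    have hl : (W + (Real.exp (-1) - 1) * σ) ^ M ≤ W ^ M * Real.exp (μ * (-(1 / 2))) := by
      refine (hpow _ (by nlinarith)).trans ?_
      gcongr
      nlinarith
    have hu : (W + (Real.exp 1 - 1) * σ) ^ M ≤ W ^ M * Real.exp (μ * (2 * ρ)) := by
      have := Real.add_one_le_exp 1
      refine (hpow _ (by nlinarith)).trans ?_
      gcongr
      nlinarith
    calc _ ≤ Real.exp (μ / 4) * (W ^ M * Real.exp (μ * (-(1 / 2)))) +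
          Real.exp (-(4 * ρ * μ)) * (W ^ M * Real.exp (μ * (2 * ρ))) := by gcongr
      _ = W ^ M * (Real.exp (-(μ / 4)) + Real.exp (-(2 * ρ * μ))) := by
        rw [mul_left_comm, mul_left_comm (Real.exp (-(4 * ρ * μ))), ← Real.exp_add,
          ← Real.exp_add, mul_add]
        ring_nf
      _ ≤ W ^ M * (2 * Real.exp (-(μ / 4))) := by
        have : Real.exp (-(2 * ρ * μ)) ≤ Real.exp (-(μ / 4)) := by
          gcongr
          nlinarith
        gcongr
        linarith
  have htotal : W ^ M ≤ 𝓕.card * (W ^ M * (2 * Real.exp (-(μ / 4)))) := by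
    calc W ^ M = ∑ f : Fin M → P, ∏ i, w (f i) := by rw [← hW, Fintype.sum_pow]
      _ ≤ ∑ f : Fin M → P, (∏ i, w (f i)) * ∑ X ∈ 𝓕, (Real.exp (μ / 4) * Real.exp (-1 * h f X) +
          Real.exp (-(4 * ρ * μ)) * Real.exp (1 * h f X)) := by
        refine Finset.sum_le_sum fun f _ => ?_
        by_cases hf : ∀ i, w (f i) ≠ 0
        · exact le_mul_of_one_le_right (Finset.prod_nonneg fun i _ => hw _) (hone f hf)
        · push Not at hf
          obtain ⟨i, hi⟩ := hf
          rw [Finset.prod_eq_zero (Finset.mem_univ i) hi, zero_mul]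
      _ = ∑ X ∈ 𝓕, (Real.exp (μ / 4) * ∑ f : Fin M → P, (∏ i, w (f i)) * Real.exp (-1 * h f X) +
          Real.exp (-(4 * ρ * μ)) *
            ∑ f : Fin M → P, (∏ i, w (f i)) * Real.exp (1 * h f X)) := by
        simp only [Finset.mul_sum]
        rw [Finset.sum_comm]
        refine Finset.sum_congr rfl fun X _ => ?_
        rw [← Finset.sum_add_distrib]
        exact Finset.sum_congr rfl fun f _ => by ring
      _ ≤ ∑ X ∈ 𝓕, W ^ M * (2 * Real.exp (-(μ / 4))) := by
        refine Finset.sum_le_sum fun X hX => ?_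
        rw [hmoment, hmoment]
        exact hterm X hX
      _ = _ := by rw [Finset.sum_const, nsmul_eq_mul]
  nlinarith

/-- Sparsification: quasirandom weights on `a * n` points can be replaced by quasirandom weights
whose support has bounded degree after discarding at most `n` points. -/
theorem exists_sparsification (a : ℕ) (ha : 0 < a) (ρ : ℝ) (hρ : 1 ≤ ρ) :
    ∃ D : ℕ, ∀ n : ℕ, 0 < n → ∀ (I : Type) [Fintype I] [DecidableEq I] (w : I → I → ℝ),
      Fintype.card I = a * n → (∀ x y, 0 ≤ w x y) →
      (∀ X Y : Finset I, X.card = n → Y.card = n →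
        1 ≤ ∑ x ∈ X, ∑ y ∈ Y, w x y ∧ ∑ x ∈ X, ∑ y ∈ Y, w x y ≤ ρ) →
      ∃ (w' : I → I → ℝ) (J : Finset I), a * n ≤ J.card + n ∧ (∀ x y, 0 ≤ w' x y) ∧
        (∀ x y, w' x y ≠ 0 → w x y ≠ 0) ∧
        (∀ X Y : Finset I, X.card = n → Y.card = n →
          1 ≤ ∑ x ∈ X, ∑ y ∈ Y, w' x y ∧ ∑ x ∈ X, ∑ y ∈ Y, w' x y ≤ 16 * ρ) ∧
        ∀ x ∈ J, (Finset.univ.filter fun y => w' x y ≠ 0 ∨ w' y x ≠ 0).card ≤ D := by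
  classical
  -- Since `W ≤ a ^ 2 * ρ`, drawing `C * n` pairs gives `μ ≥ 17 * a * n`, and `exp (-μ / 4)` beats
  -- the at most `4 ^ (a * n)` pairs of `n`-sets.
  obtain ⟨C, hC⟩ := exists_nat_ge (17 * (a : ℝ) ^ 3 * ρ)
  have ha1 : (1 : ℝ) ≤ a := by exact_mod_cast ha
  have hC0 : (0 : ℝ) < C := lt_of_lt_of_le (by positivity) hC
  refine ⟨2 * C, fun n hn I _ _ w hI hw hX => ?_⟩
  have hn1 : (1 : ℝ) ≤ n := by exact_mod_cast hn
  set W := ∑ p : I × I, w p.1 p.2 with hW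
  have hW' : W = ∑ x, ∑ y, w x y := Fintype.sum_prod_type _
  have hWle : W ≤ a ^ 2 * ρ := hW' ▸ sum_weight_le a n hI w ρ fun X Y h h' => (hX X Y h h').2
  have hW1 : 1 ≤ W := by
    obtain ⟨X, -, hXc⟩ := Finset.exists_subset_card_eq (s := (Finset.univ : Finset I)) (n := n)
      (by rw [Finset.card_univ, hI]; exact Nat.le_mul_of_pos_left n ha)
    refine (hX X X hXc hXc).1.trans ?_
    rw [hW']
    refine (Finset.sum_le_sum_of_subset_of_nonneg (Finset.subset_univ X)
      fun x _ _ => Finset.sum_nonneg fun y _ => hw x y).trans ?_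
    exact Finset.sum_le_sum fun x _ => Finset.sum_le_sum_of_subset_of_nonneg
      (Finset.subset_univ X) fun y _ _ => hw x y
  have hW0 : 0 < W := by linarith
  let 𝓕 : Finset (Finset I × Finset I) :=
    Finset.powersetCard n Finset.univ ×ˢ Finset.powersetCard n Finset.univ
  have h𝓕 : ∀ X Y : Finset I, (X, Y) ∈ 𝓕 ↔ X.card = n ∧ Y.card = n := by
    intro X Y
    simp [𝓕, Finset.mem_powersetCard]
  set μ : ℝ := ((C * n : ℕ) : ℝ) / W with hμ
  have hμge : 17 * a * n ≤ μ := by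
    rw [hμ, le_div_iff₀ hW0]
    push_cast
    calc 17 * a * n * W ≤ 17 * a * n * (a ^ 2 * ρ) := by gcongr
      _ = (17 * (a : ℝ) ^ 3 * ρ) * n := by ring
      _ ≤ C * n := by gcongr
  have hcard : (𝓕.card : ℝ) ≤ Real.exp (2 * (a * n)) := by
    have h1 : 𝓕.card ≤ 2 ^ (a * n) * 2 ^ (a * n) := by
      rw [Finset.card_product, Finset.card_powersetCard, Finset.card_univ, hI]
      exact Nat.mul_le_mul (Nat.choose_le_two_pow _ _) (Nat.choose_le_two_pow _ _)
    have h2 : (2 : ℝ) ≤ Real.exp 1 := by have := Real.add_one_le_exp 1; linarith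
    calc (𝓕.card : ℝ) ≤ 2 ^ (a * n) * 2 ^ (a * n) := by exact_mod_cast h1
      _ ≤ Real.exp 1 ^ (a * n) * Real.exp 1 ^ (a * n) := by gcongr
      _ = _ := by
        rw [← pow_add, ← Real.exp_nat_mul]
        push_cast
        ring_nf
  have han : (1 : ℝ) ≤ a * n := one_le_mul_of_one_le_of_one_le ha1 hn1
  have hM : (𝓕.card : ℝ) * (2 * Real.exp (-(μ / 4))) < 1 := by
    have h2 : (2 : ℝ) ≤ Real.exp 1 := by have := Real.add_one_le_exp 1; linarith
    calc (𝓕.card : ℝ) * (2 * Real.exp (-(μ / 4))) ≤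
          Real.exp (2 * (a * n)) * (Real.exp 1 * Real.exp (-(μ / 4))) := by gcongr
      _ = Real.exp (2 * (a * n) + (1 + -(μ / 4))) := by rw [Real.exp_add, Real.exp_add]
      _ < 1 := Real.exp_lt_one_iff.2 (by nlinarith)
  have hprod : ∀ (X Y : Finset I) (g : I × I → ℝ),
      ∑ p ∈ X ×ˢ Y, g p = ∑ x ∈ X, ∑ y ∈ Y, g (x, y) := fun X Y g => Finset.sum_product _ _ _
  obtain ⟨f, hf0, hf⟩ := exists_sample (fun p : I × I => w p.1 p.2) (fun p => hw _ _) W rfl hW0 𝓕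
    (fun XY => XY.1 ×ˢ XY.2) ρ hρ (by
      rintro ⟨X, Y⟩ hXY
      rw [h𝓕] at hXY
      rw [hprod]
      exact hX X Y hXY.1 hXY.2) (C * n) hM
  have hμ0 : 0 < μ / 4 := by nlinarith
  let d : I → ℕ := fun x => (Finset.univ.filter fun i => (f i).1 = x).card +
    (Finset.univ.filter fun i => (f i).2 = x).card
  have hd : ∑ x, d x = 2 * (C * n) := by
    have h1 := Finset.card_eq_sum_card_fiberwise (s := (Finset.univ : Finset (Fin (C * n))))
      (f := fun i => (f i).1) (t := Finset.univ) (by simp)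
    have h2 := Finset.card_eq_sum_card_fiberwise (s := (Finset.univ : Finset (Fin (C * n))))
      (f := fun i => (f i).2) (t := Finset.univ) (by simp)
    rw [Finset.card_univ, Fintype.card_fin] at h1 h2
    rw [Finset.sum_add_distrib, ← h1, ← h2]
    ring
  have hne : ∀ x y, ((Finset.univ.filter fun i => f i = (x, y)).card : ℝ) / (μ / 4) ≠ 0 →
      ∃ i, f i = (x, y) := by
    intro x y h
    by_contra! hcon
    exact h (by rw [Finset.filter_eq_empty_iff.2 fun i _ => hcon i]; simp)
  have hsum : ∀ X Y : Finset I, ∑ x ∈ X, ∑ y ∈ Y,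
      ((Finset.univ.filter fun i => f i = (x, y)).card : ℝ) / (μ / 4) =
      ((Finset.univ.filter fun i => f i ∈ X ×ˢ Y).card : ℝ) / (μ / 4) := by
    intro X Y
    rw [← hprod X Y fun p => ((Finset.univ.filter fun i => f i = p).card : ℝ) / (μ / 4),
      ← Finset.sum_div]
    congr 1
    rw [Finset.card_eq_sum_card_fiberwise (s := Finset.univ.filter fun i => f i ∈ X ×ˢ Y) (f := f)
      (t := X ×ˢ Y) (fun i hi => (Finset.mem_filter.1 hi).2)]
    push_cast
    refine Finset.sum_congr rfl fun p hp => ?_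
    rw [Finset.filter_filter]
    congr 2
    ext i
    simp only [Finset.mem_filter, Finset.mem_univ, true_and]
    exact ⟨fun h => ⟨h ▸ hp, h⟩, fun h => h.2⟩
  -- Dividing multiplicities by `μ / 4` turns the bounds `μ / 4` and `4 * ρ * μ` into `1` and `16 *
  -- ρ`. The sampled degrees sum to `2 * C * n`, so at most `n` points exceed `2 * C`.
  refine ⟨fun x y => ((Finset.univ.filter fun i => f i = (x, y)).card : ℝ) / (μ / 4),
    Finset.univ.filter fun x => d x ≤ 2 * C, ?_, fun x y => by positivity, ?_, ?_, ?_⟩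
  · have h1 := Finset.card_filter_add_card_filter_not (s := (Finset.univ : Finset I))
      (p := fun x => d x ≤ 2 * C)
    rw [Finset.card_univ, hI] at h1
    have h2 : (Finset.univ.filter fun x => ¬ d x ≤ 2 * C).card * (2 * C) ≤ 2 * (C * n) := by
      rw [← hd, ← smul_eq_mul, ← Finset.sum_const]
      exact (Finset.sum_le_sum fun x hx => (not_le.1 (Finset.mem_filter.1 hx).2).le).trans
        (Finset.sum_le_sum_of_subset (Finset.subset_univ _))
    have hC1 : 0 < 2 * C := by
      have : 0 < C := by exact_mod_cast hC0
      omega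
    have h3 : (Finset.univ.filter fun x => ¬ d x ≤ 2 * C).card ≤ n :=
      Nat.le_of_mul_le_mul_right (by linarith) hC1
    omega
  · intro x y h
    obtain ⟨i, hi⟩ := hne x y h
    have := hf0 i
    rwa [hi] at this
  · intro X Y hXc hYc
    obtain ⟨h1, h2⟩ := hf (X, Y) ((h𝓕 X Y).2 ⟨hXc, hYc⟩)
    rw [hsum]
    refine ⟨(one_le_div hμ0).2 h1, (div_le_iff₀ hμ0).2 (h2.trans (le_of_eq ?_))⟩
    ring
  · intro x hx
    refine le_trans ?_ (Finset.mem_filter.1 hx).2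
    have hsub : (Finset.univ.filter fun y =>
        ((Finset.univ.filter fun i => f i = (x, y)).card : ℝ) / (μ / 4) ≠ 0 ∨
        ((Finset.univ.filter fun i => f i = (y, x)).card : ℝ) / (μ / 4) ≠ 0) ⊆
        ((Finset.univ.filter fun i => (f i).1 = x).image fun i => (f i).2) ∪
        ((Finset.univ.filter fun i => (f i).2 = x).image fun i => (f i).1) := by
      intro y hy
      rcases (Finset.mem_filter.1 hy).2 with h | h
      · obtain ⟨i, hi⟩ := hne _ _ h
        exact Finset.mem_union_left _ (Finset.mem_image.2 ⟨i, by simp [hi], by simp [hi]⟩)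
      · obtain ⟨i, hi⟩ := hne _ _ h
        exact Finset.mem_union_right _ (Finset.mem_image.2 ⟨i, by simp [hi], by simp [hi]⟩)
    exact (Finset.card_le_card hsub).trans ((Finset.card_union_le _ _).trans
      (Nat.add_le_add Finset.card_image_le Finset.card_image_le))

/-! ### The induction on the number of colours -/

/-- `w` is a weighting of pairs, supported on the edges of `G`, that gives every pair of disjoint
`n`-sets a weight between `1` and `ρ`. -/
structure IsQuasirandomWeight {V : Type*} (G : SimpleGraph V) (w : V → V → ℝ) (ρ : ℝ) (n : ℕ) :
    Prop where
  nonneg : ∀ x y, 0 ≤ w x y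
  adj : ∀ x y, x ≠ y → w x y ≠ 0 → G.Adj x y
  bounds : ∀ X Y : Finset V, Disjoint X Y → X.card = n → Y.card = n →
    1 ≤ ∑ x ∈ X, ∑ y ∈ Y, w x y ∧ ∑ x ∈ X, ∑ y ∈ Y, w x y ≤ ρ

theorem IsQuasirandomWeight.exists_adj {V : Type*} {G : SimpleGraph V} {w : V → V → ℝ} {ρ : ℝ}
    {n : ℕ} (h : IsQuasirandomWeight G w ρ n) (X Y : Finset V) (hd : Disjoint X Y)
    (hX : X.card = n) (hY : Y.card = n) : ∃ x ∈ X, ∃ y ∈ Y, G.Adj x y := by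
  by_contra! hcon
  have h1 := (h.bounds X Y hd hX hY).1
  rw [Finset.sum_eq_zero fun x hx => Finset.sum_eq_zero fun y hy => ?_] at h1
  · linarith
  · by_contra hne
    exact hcon x hx y hy (h.adj x y (Finset.disjoint_iff_ne.1 hd x hx y hy) hne)

/-- Every covering of a sheared blow-up of a power of a large quasirandom graph by `s` graphs has
a member containing the `k`-th power of a path. -/
def PathPowerRamsey.{u} (k s : ℕ) : Prop :=
  ∀ ρ : ℝ, 1 ≤ ρ → ∃ r t a n₀ : ℕ, 0 < r ∧ 2 ≤ t ∧ ∀ n : ℕ, n₀ ≤ n →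
    ∀ (V : Type u) [Fintype V] [DecidableEq V] (G : SimpleGraph V) (w : V → V → ℝ),
      a * n ≤ Fintype.card V → IsQuasirandomWeight G w ρ n →
      ∀ K : SimpleGraph (V × Fin t), IsShearedBlowup (graphPower G r) t K →
      ∀ R : Fin s → SimpleGraph (V × Fin t), (∀ x y, K.Adj x y → ∃ i, (R i).Adj x y) →
        ∃ i, (graphPower (pathGraph n) k).IsContained (R i)

theorem pathPowerRamsey_zero (k : ℕ) : PathPowerRamsey k 0 := by
  intro ρ _
  refine ⟨1, 2, 1, 1, one_pos, le_rfl, fun n hn V _ _ G w hV _ K hK R hR => ?_⟩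
  obtain ⟨M, hM, -, rfl⟩ := hK
  obtain ⟨v⟩ : Nonempty V := Fintype.card_pos_iff.1 (by omega)
  -- As `t = 2`, there is an edge inside `C(v)`, and no graph is available to cover it.
  obtain ⟨i, _⟩ := hR (v, 0) (v, 1) ⟨Or.inl ⟨rfl, by simp⟩, fun h => (hM _ _ h).ne rfl⟩
  exact i.elim0

/-- Disjoint transversal paths through large disjoint sets of a quasirandom graph are the vertices of
a quasirandom graph of bounded degree. -/
theorem exists_quasirandom_paths (a : ℕ) (ρ : ℝ) (hρ : 1 ≤ ρ) : ∃ D : ℕ, ∀ n : ℕ, 0 < n →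
    ∀ (V : Type*) [DecidableEq V] (G : SimpleGraph V) (w : V → V → ℝ),
      IsQuasirandomWeight G w ρ n → ∀ (ℓ : ℕ), 2 ≤ ℓ → ∀ A : ℕ → Finset V,
      (∀ i < ℓ, (A i).card = (a + 3) * n) →
      (∀ i < ℓ, ∀ j < ℓ, i ≠ j → Disjoint (A i) (A j)) →
      ∃ (J : Type) (_ : Fintype J) (_ : DecidableEq J) (G' : SimpleGraph J) (w' : J → J → ℝ)
        (nb : J → Finset J) (p : J → Fin ℓ → V),
        a * n ≤ Fintype.card J ∧ IsQuasirandomWeight G' w' (16 * ρ) n ∧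
        (∀ x y, G'.Adj x y → y ∈ nb x) ∧ (∀ x, (nb x).card ≤ D) ∧ (∀ x (i : Fin ℓ), p x i ∈ A i) ∧
        (∀ x y i, p x i = p y i → x = y) ∧
        ∀ (r : ℕ) x y, G'.edist x y ≤ r → ∀ i j, G.edist (p x i) (p y j) ≤ (2 * r + 2 * ℓ : ℕ) := by
  classical
  obtain ⟨D, hD⟩ := exists_sparsification (a + 1) a.succ_pos ρ hρ
  refine ⟨D, fun n hn V _ G w hw ℓ hℓ A hAc hAd => ?_⟩
  -- Of the `(a + 3) * n` vertices in each set, `2 * n` are spare for finding paths; `n` of the `(a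
  -- + 1) * n` paths may be lost in sparsification.
  obtain ⟨p, hpA, hpadj, hpinj⟩ := exists_disjoint_transversal_paths G n hn hw.exists_adj (ℓ - 1)
    ((a + 1) * n) A (fun i hi => hAd i (by omega) (i + 1) (by omega) (by omega))
    (fun i hi => by rw [hAc i (by omega)]; linarith)
  have hne : ∀ x y : Fin ((a + 1) * n), p x 0 ≠ p y 1 := fun x y =>
    Finset.disjoint_iff_ne.1 (hAd 0 (by omega) 1 (by omega) (by omega)) _
      (hpA x x.2 0 (by omega)) _ (hpA y y.2 1 (by omega))
  have hinj : ∀ i ≤ ℓ - 1, Function.Injective fun x : Fin ((a + 1) * n) => p x i :=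
    fun i hi x y h => Fin.ext (hpinj x x.2 y y.2 i hi h)
  -- The weight of `(x, y)` is read between `A 0` and `A 1`. These are disjoint, so the bounds hold
  -- even for overlapping sets of paths.
  obtain ⟨w', J, hJ, hw0, hww, hwb, hdeg⟩ := hD n hn (Fin ((a + 1) * n))
    (fun x y => w (p x 0) (p y 1)) (Fintype.card_fin _) (fun x y => hw.nonneg _ _) (by
      intro X Y hX hY
      have := hw.bounds (X.image fun x : Fin ((a + 1) * n) => p x 0)
        (Y.image fun y : Fin ((a + 1) * n) => p y 1) (by
        rw [Finset.disjoint_iff_ne]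
        intro u hu v hv
        obtain ⟨x, -, rfl⟩ := Finset.mem_image.1 hu
        obtain ⟨y, -, rfl⟩ := Finset.mem_image.1 hv
        exact hne x y)
        (by rw [Finset.card_image_of_injective _ (hinj 0 (by omega)), hX])
        (by rw [Finset.card_image_of_injective _ (hinj 1 (by omega)), hY])
      rw [Finset.sum_image fun _ _ _ _ h => hinj 0 (by omega) h] at this
      simp only [Finset.sum_image fun _ _ _ _ h => hinj 1 (by omega) h] at this
      exact this)
  let G' : SimpleGraph J := SimpleGraph.fromRel fun x y => w' x y ≠ 0
  have hedge : ∀ x y, w' x y ≠ 0 → G.Adj (p x 0) (p y 1) := fun x y h =>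
    hw.adj _ _ (hne x y) (hww x y h)
  -- The edge of `G` from `p x 0` to `p y 1` is followed by one step back along the path of `y`.
  have hstep : ∀ x y : J, G'.Adj x y → G.edist (p x 0) (p y 0) ≤ 2 := by
    have key : ∀ x y : J, w' x y ≠ 0 → G.edist (p x 0) (p y 0) ≤ 2 := fun x y h =>
      (edist_le (Walk.cons (hedge x y h)
        (Walk.cons (hpadj y y.1.2 0 (by omega)).symm Walk.nil))).trans (by simp)
    intro x y hxy
    rcases ((fromRel_adj _ _ _).1 hxy).2 with h | h
    · exact key x y h
    · rw [SimpleGraph.edist_comm]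
      exact key y x h
  have hwalk : ∀ (x y : J) (q : G'.Walk x y), G.edist (p x 0) (p y 0) ≤ (2 * q.length : ℕ) := by
    intro x y q
    induction q with
    | nil => simp
    | cons h q ih =>
      refine G.edist_triangle.trans ((add_le_add (hstep _ _ h) ih).trans ?_)
      rw [Walk.length_cons]
      norm_cast
      omega
  have hpath : ∀ (x : J) (i : ℕ), i ≤ ℓ - 1 → G.edist (p x 0) (p x i) ≤ i := by
    intro x i
    induction i with
    | zero => simp
    | succ i ih =>
      intro hi
      refine G.edist_triangle.trans ((add_le_add (ih (by omega))
        (edist_eq_one_iff_adj.2 (hpadj x x.1.2 i (by omega))).le).trans ?_)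
      norm_cast
  refine ⟨J, inferInstance, inferInstance, G', fun x y => w' x y,
    fun x => Finset.univ.filter fun y => w' x y ≠ 0 ∨ w' y x ≠ 0, fun x i => p x i,
    ?_, ⟨fun x y => hw0 x y, ?_, ?_⟩, ?_, ?_, ?_, ?_, ?_⟩
  · rw [Fintype.card_coe]
    linarith
  · intro x y hxy h
    exact (fromRel_adj _ _ _).2 ⟨hxy, Or.inl h⟩
  · intro X Y _ hX hY
    have := hwb (X.map (Function.Embedding.subtype _)) (Y.map (Function.Embedding.subtype _))
      (by rw [Finset.card_map, hX]) (by rw [Finset.card_map, hY])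
    simpa only [Finset.sum_map, Function.Embedding.subtype_apply] using this
  · intro x y hxy
    exact Finset.mem_filter.2 ⟨Finset.mem_univ _, ((fromRel_adj _ _ _).1 hxy).2⟩
  · intro x
    rw [← Finset.card_map (Function.Embedding.subtype _)]
    refine (Finset.card_le_card ?_).trans (hdeg x x.2)
    intro y hy
    obtain ⟨z, hz, rfl⟩ := Finset.mem_map.1 hy
    exact Finset.mem_filter.2 ⟨Finset.mem_univ _, (Finset.mem_filter.1 hz).2⟩
  · exact fun x i => hpA x x.1.2 i (by omega)
  · exact fun x y i h => Subtype.ext (hinj i (by omega) h)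
  · intro r x y hxy i j
    obtain ⟨q, hq⟩ := (reachable_of_edist_ne_top
      (ne_top_of_le_ne_top (ENat.natCast_ne_top r) hxy)).exists_walk_length_eq_edist
    rw [← hq] at hxy
    have hqr : q.length ≤ r := by exact_mod_cast hxy
    have h1 := hpath x i (by omega)
    rw [SimpleGraph.edist_comm] at h1
    refine G.edist_triangle.trans ((add_le_add h1 (G.edist_triangle.trans
      (add_le_add (hwalk x y q) (hpath y j (by omega))))).trans ?_)
    norm_cast
    omega

/-- In a sheared blow-up of `H` covered by graphs, every `C(v)` has a large monochromatic clique. -/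
theorem exists_mono_clique_in_blowup (s T : ℕ) : ∃ N : ℕ, ∀ {V : Type*} [DecidableEq V] (t : ℕ),
    N ≤ t → ∀ (H : SimpleGraph V) (K : SimpleGraph (V × Fin t)), IsShearedBlowup H t K →
    ∀ R : Fin s → SimpleGraph (V × Fin t), (∀ x y, K.Adj x y → ∃ i, (R i).Adj x y) →
    ∀ v, ∃ i, ∃ B : Finset (V × Fin t), (∀ x ∈ B, x.1 = v) ∧ T ≤ B.card ∧
      ∀ x ∈ B, ∀ y ∈ B, x ≠ y → (R i).Adj x y := by
  obtain ⟨N, hN⟩ := exists_ramsey_bound (s := s) _ (fun _ => T) rfl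
  refine ⟨N, fun {V} _ t ht H K hK R hR v => ?_⟩
  obtain ⟨M, hM, -, rfl⟩ := hK
  obtain ⟨i, B, -, hB, hmono⟩ := hN (fun i x y => (R i).Adj (v, x) (v, y))
    (fun i x y h => h.symm) (Finset.univ : Finset (Fin t)) (by simpa using ht)
    fun x _ y _ hxy => hR _ _ ⟨Or.inl ⟨rfl, hxy⟩, fun h => (hM _ _ h).ne rfl⟩
  refine ⟨i, B.image fun x => (v, x), ?_, ?_, ?_⟩
  · intro x hx
    obtain ⟨y, -, rfl⟩ := Finset.mem_image.1 hx
    rfl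
  · rwa [Finset.card_image_of_injective _ fun x y h => (Prod.ext_iff.1 h).2]
  · intro x hx y hy hxy
    obtain ⟨x, hxB, rfl⟩ := Finset.mem_image.1 hx
    obtain ⟨y, hyB, rfl⟩ := Finset.mem_image.1 hy
    exact hmono x hxB y hyB fun h => hxy (by rw [h])

/-- Among `2 * q` vertices of `C(v)`, at least `q` are joined to all of `q` given vertices of `C(u)`. -/
theorem IsShearedBlowup.exists_complete_pair {V : Type*} [DecidableEq V] {H : SimpleGraph V} {t : ℕ}
    {K : SimpleGraph (V × Fin t)} (hK : IsShearedBlowup H t K) {u v : V} (huv : H.Adj u v) (q : ℕ)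
    (X Y : Finset (V × Fin t)) (hX : ∀ x ∈ X, x.1 = u) (hY : ∀ y ∈ Y, y.1 = v) (hXc : X.card = q)
    (hYc : Y.card = 2 * q) : ∃ Z ⊆ Y, Z.card = q ∧ ∀ x ∈ X, ∀ y ∈ Z, K.Adj x y := by
  obtain ⟨M, -, hM, rfl⟩ := hK
  -- Each vertex of `X` has a single deleted partner in `C(v)`, so at most `q` elements of `Y` are
  -- lost.
  choose g _ hg using fun i => hM u v huv i
  obtain ⟨Z, hZ, hZc⟩ := Finset.exists_subset_card_eq
    (show q ≤ (Y \ X.image fun x => (v, g x.2)).card by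
      have h1 := Finset.le_card_sdiff (X.image fun x => (v, g x.2)) Y
      have h2 : (X.image fun x => (v, g x.2)).card ≤ X.card := Finset.card_image_le
      omega)
  refine ⟨Z, hZ.trans Finset.sdiff_subset, hZc, fun x hx y hy => ?_⟩
  obtain ⟨hyY, hyX⟩ := Finset.mem_sdiff.1 (hZ hy)
  have hx1 := hX x hx
  have hy1 := hY y hyY
  obtain ⟨x1, x2⟩ := x
  obtain ⟨y1, y2⟩ := y
  dsimp only at hx1 hy1
  subst hx1 hy1
  refine ⟨Or.inr huv, fun h => hyX (Finset.mem_image.2 ⟨_, hx, ?_⟩)⟩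
  rw [hg x2 y2 h]

/-- The constants are fixed in the order `r'`, `ℓ`, `a'`, then `D`, then the clique size, so `t`
does not depend on `n`. The factor `s + 1` pays for the majority colour, and `a' + 6` for parts of
size `(a' + 3) * n` plus the `n + 2` vertices of the excluded path. -/
theorem pathPowerRamsey_succ.{u} (k s : ℕ) (hk : 0 < k) (ih : PathPowerRamsey.{0} k s) :
    PathPowerRamsey.{u} k (s + 1) := by
  classical
  intro ρ hρ
  obtain ⟨r', ℓ, a', n₀, hr', hℓ, ih⟩ := ih (16 * ρ) (by linarith)
  obtain ⟨D, hD⟩ := exists_quasirandom_paths.{u} a' ρ hρ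
  set Δ := (D + 1) ^ r' * ℓ with hΔ
  set q := 2 * k with hq
  obtain ⟨N, hN⟩ := exists_mono_clique_in_blowup.{u} (s + 1) ((2 * q) ^ Δ * (Δ * q + 4 * q))
  refine ⟨2 * r' + 2 * ℓ, max N 2, (s + 1) * (ℓ * (a' + 6)), max n₀ 1, by omega, le_max_right _ _,
    fun n hn V _ _ G w hV hw K hK R hR => ?_⟩
  have hn1 : 1 ≤ n := (le_max_right _ _).trans hn
  choose col B hBv hBc hB using hN _ (le_max_left _ _) _ K hK R hR
  obtain ⟨b, hb⟩ := Fintype.exists_le_card_fiber_of_mul_le_card (f := col)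
    (n := ℓ * (a' + 6) * n) (by rw [Fintype.card_fin]; linarith)
  let B' : V → Finset (V × Fin (max N 2)) := fun v => if col v = b then B v else ∅
  have hB'B : ∀ v, B' v ⊆ B v := fun v => by
    dsimp only [B']
    split_ifs <;> simp
  have hB' : ∀ v, ∀ x ∈ B' v, ∀ y ∈ B' v, x ≠ y → (R b).Adj x y := by
    intro v x hx y hy hxy
    by_cases hv : col v = b
    · exact hv ▸ hB v x (hB'B v hx) y (hB'B v hy) hxy
    · simp [B', hv] at hx
  have hBd : ∀ u v, u ≠ v → Disjoint (B u) (B v) := fun u v huv =>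
    Finset.disjoint_left.2 fun x hx hx' => huv ((hBv u x hx).symm.trans (hBv v x hx'))
  let rel : V → V → Prop := fun u v => (graphPower G (2 * r' + 2 * ℓ)).Adj u v ∧
    ∃ X ⊆ B' u, ∃ Y ⊆ B' v, X.card = q ∧ Y.card = q ∧ ∀ x ∈ X, ∀ y ∈ Y, (R b).Adj x y
  have hrel : ∀ u v, rel u v → rel v u := by
    rintro u v ⟨h, X, hX, Y, hY, hXc, hYc, hXY⟩
    exact ⟨h.symm, Y, hY, X, hX, hYc, hXc, fun y hy x hx => (hXY x hx y hy).symm⟩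
  rcases exists_path_or_parts rel hrel (n + 2) ((a' + 3) * n) ℓ
    (Finset.univ.filter fun v => col v = b) (le_trans (by
      rw [mul_assoc]
      exact Nat.mul_le_mul_left _ (by nlinarith)) hb) with ⟨l, hl, hnd, hch⟩ | ⟨A, hA, hAA⟩
  · exact ⟨b, graphPower_pathGraph_isContained_of_cliques (R b) n k hk B' hB'
      (fun u v huv => Finset.disjoint_of_subset_left (hB'B u)
        (Finset.disjoint_of_subset_right (hB'B v) (hBd u v huv))) l hl hnd
      (hch.imp fun u v h => h.2)⟩
  obtain ⟨J, _, _, G', w', nb, p, hJ, hw', hnb, hnbD, hpA, hpinj, hdist⟩ := hD n hn1 V G w hw ℓ hℓ A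
    (fun i hi => (hA i hi).2) fun i hi j hj hij => (hAA i hi j hj hij).1
  have hcol : ∀ x i, col (p x i) = b := fun x i =>
    (Finset.mem_filter.1 ((hA i i.2).1 (hpA x i))).2
  let adj : J × Fin ℓ → J × Fin ℓ → Prop := fun x y =>
    x.2 ≠ y.2 ∧ (x.1 = y.1 ∨ (graphPower G' r').Adj x.1 y.1)
  -- A pair is usable when it is an edge of `K` outside `R b`; some other member of the covering
  -- must then contain it.
  let bad : V × Fin (max N 2) → V × Fin (max N 2) → Prop := fun x y =>
    ¬ (K.Adj x y ∧ ¬ (R b).Adj x y)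
  choose S hS hSball using exists_ball_card_le G' nb hnb D hnbD r'
  obtain ⟨f, hfB, hf⟩ := exists_good_transversal adj (fun x h => h.1 rfl)
    (fun x y h => ⟨h.1.symm, h.2.imp Eq.symm fun h => h.symm⟩) q Δ (by omega)
    (fun x => S x.1 ×ˢ Finset.univ) (by
      intro x y h
      refine Finset.mem_product.2 ⟨hSball _ _ ?_, Finset.mem_univ _⟩
      rcases h.2 with h | h
      · rw [h, edist_self]
        exact zero_le
      · exact h.2)
    (fun x => by
      rw [Finset.card_product, Finset.card_univ, Fintype.card_fin]
      exact Nat.mul_le_mul_right _ (hS _))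
    bad (fun x y h h' => h ⟨h'.1.symm, fun hh => h'.2 hh.symm⟩)
    (fun x => B (p x.1 x.2)) (fun x => hBc _) (by
      -- If all pairs were bad, the edges of `K` between `X` and `Y` would all lie in `R b`; a
      -- complete pair of `q`-sets among them would relate vertices of different parts.
      intro x y hxy X hX Y hY hXc hYc
      by_contra! hcon
      have hd := hAA x.2 x.2.2 y.2 y.2.2 fun h => hxy.1 (Fin.ext h)
      have hpow : (graphPower G (2 * r' + 2 * ℓ)).Adj (p x.1 x.2) (p y.1 y.2) := by
        refine ⟨Finset.disjoint_iff_ne.1 hd.1 _ (hpA _ _) _ (hpA _ _), hdist r' _ _ ?_ _ _⟩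
        rcases hxy.2 with h | h
        · rw [h, edist_self]
          exact zero_le
        · exact h.2
      obtain ⟨Z, hZY, hZc, hZ⟩ := hK.exists_complete_pair hpow q X Y
        (fun z hz => hBv _ z (hX hz)) (fun z hz => hBv _ z (hY hz)) hXc hYc
      refine hd.2 _ (hpA _ _) _ (hpA _ _) ⟨hpow, X, ?_, Z, ?_, hXc, hZc, fun z hz z' hz' => ?_⟩
      · simpa only [B', hcol, if_true] using hX
      · simpa only [B', hcol, if_true] using hZY.trans hY
      · exact hcon z hz z' (hZY hz') (hZ z hz z' hz'))
  have hfinj : Function.Injective f := by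
    intro x y hxy
    have h1 : p x.1 x.2 = p y.1 y.2 := by
      rw [← hBv _ _ (hfB x), ← hBv _ _ (hfB y), hxy]
    have h2 : x.2 = y.2 := by
      by_contra hne
      exact Finset.disjoint_iff_ne.1 (hAA x.2 x.2.2 y.2 y.2.2 fun h => hne (Fin.ext h)).1 _
        (hpA _ _) _ (hpA _ _) h1
    rw [h2] at h1
    exact Prod.ext (hpinj _ _ _ h1) h2
  -- Equal second coordinates mean vertices in the same part, where `adj` demands nothing.
  let M' : SimpleGraph (J × Fin ℓ) :=
    { Adj := fun x y => (graphPower G' r').Adj x.1 y.1 ∧ x.2 = y.2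
      symm := ⟨fun _ _ h => ⟨h.1.symm, h.2.symm⟩⟩
      loopless := ⟨fun _ h => h.1.ne rfl⟩ }
  obtain ⟨c, hc⟩ := ih n ((le_max_left _ _).trans hn) J G' w' hJ hw'
    (completeBlowup (graphPower G' r') ℓ \ M')
    ⟨M', fun x y h => h.1, fun u v huv i => ⟨i, ⟨huv, rfl⟩, fun j hj => hj.2.symm⟩, rfl⟩
    (fun c => (R (b.succAbove c)).comap f) (by
      rintro x y ⟨h, hM⟩
      have hxy : adj x y := by
        rcases h with h | h
        · exact ⟨h.2, Or.inl h.1⟩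
        · exact ⟨fun hh => hM ⟨h, hh⟩, Or.inr h⟩
      obtain ⟨hKf, hRf⟩ := not_not.1 (hf x y hxy)
      obtain ⟨i, hi⟩ := hR _ _ hKf
      obtain ⟨c, rfl⟩ := Fin.exists_succAbove_eq (show i ≠ b from fun h => hRf (h ▸ hi))
      exact ⟨c, hi⟩)
  exact ⟨b.succAbove c, hc.trans ⟨⟨⟨f, fun h => h⟩, hfinj⟩⟩⟩

theorem pathPowerRamsey.{u} (k s : ℕ) (hk : 0 < k) : PathPowerRamsey.{u} k s := by
  -- The auxiliary graphs live on types in `Type`, so the induction runs in universe `0` and only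
  -- the last step changes universe.
  have h0 : PathPowerRamsey.{0} k (s - 1) := by
    induction s - 1 with
    | zero => exact pathPowerRamsey_zero k
    | succ s ih => exact pathPowerRamsey_succ k s hk ih
  cases s with
  | zero => exact pathPowerRamsey_zero k
  | succ s => exact pathPowerRamsey_succ k s hk h0

/-! ### From pseudorandom graphs to weights -/

/-- The uniform weighting of the edges of a pseudorandom graph. -/
theorem IsPseudorandom.exists_quasirandomWeight {V : Type*} [Fintype V]
    {G : SimpleGraph V} [DecidableRel G.Adj] {a b : ℝ} {t n : ℕ} (hn : 0 < n)
    (hG : IsPseudorandom G a b 1 t (1 / 20) n) :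
    ∃ w : V → V → ℝ, IsQuasirandomWeight G w 2 n := by
  classical
  obtain ⟨f, hf, hdens⟩ := hG.density
  have hn0 : (0 : ℝ) < n := by exact_mod_cast hn
  have hc : ⌈(1 : ℝ) * n⌉₊ = n := by rw [one_mul, Nat.ceil_natCast]
  rw [hc] at hdens
  -- This is the least possible number of edges between two disjoint `n`-sets; the largest is `21 /
  -- 19 ≤ 2` times as big.
  set z : ℝ := 19 / 20 * f * n ^ 2 with hz
  have hz0 : 0 < z := by positivity
  refine ⟨fun x y => if G.Adj x y then 1 / z else 0, fun x y => ?_, fun x y _ h => ?_,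
    fun X Y hd hX hY => ?_⟩
  · split_ifs <;> positivity
  · by_contra hxy
    exact h (if_neg hxy)
  · have hsum : ∑ x ∈ X, ∑ y ∈ Y, (if G.Adj x y then 1 / z else 0) =
        ((G.edgeDensity X Y : ℚ) : ℝ) * n ^ 2 / z := by
      rw [← Finset.sum_product', ← Finset.sum_filter, Finset.sum_const, nsmul_eq_mul]
      have h1 : ((X ×ˢ Y).filter fun p => G.Adj p.1 p.2) = G.interedges X Y := rfl
      rw [h1, SimpleGraph.edgeDensity_def, hX, hY]
      push_cast
      field_simp
    obtain ⟨h1, h2⟩ := hdens X Y hd hX hY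
    rw [hsum, one_le_div hz0, div_le_iff₀ hz0, hz]
    constructor
    · have := mul_le_mul_of_nonneg_right h1 (sq_nonneg (n : ℝ))
      linarith
    · have := mul_le_mul_of_nonneg_right h2 (sq_nonneg (n : ℝ))
      have : 0 < f * n ^ 2 := by positivity
      linarith

end SizeRamsey

theorem mainTheorem3 (k s : ℕ) (hk : 0 < k) (hs : 0 < s) :
    ∃ (r t : ℕ) (a b c ε : ℝ), 0 < r ∧ 0 < t ∧ SizeRamsey.IsGood a b c ε ∧
      ∃ n₀ : ℕ, ∀ n : ℕ, n₀ ≤ n →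
        ∀ (V : Type*) [Fintype V] (G : SimpleGraph V) [DecidableRel G.Adj],
          SizeRamsey.IsPseudorandom G a b c t ε n →
          ∀ K : SimpleGraph (V × Fin t),
            SizeRamsey.IsShearedBlowup (SizeRamsey.graphPower G r) t K →
            SizeRamsey.Arrows K (SizeRamsey.graphPower (SimpleGraph.pathGraph n) k) s := by
  classical
  obtain ⟨r, t, a, n₀, hr, ht, h⟩ := SizeRamsey.pathPowerRamsey k s hk 2 (by norm_num)
  -- With `c = 1`, the summand `3` secures `2 * c + 1 ≤ a + 3`, and `b` is the smallest value
  -- allowed.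
  refine ⟨r, t, a + 3, 264 * (a + 3 : ℝ) ^ 2 / ((1 / 20) ^ 2 * 1 ^ 2), 1, 1 / 20, hr, by omega,
    ⟨by positivity, by positivity, one_pos, by norm_num, ?_, le_rfl, by norm_num⟩, max n₀ 1,
    fun n hn V _ G _ hG K hK χ => ?_⟩
  · have : (0 : ℝ) ≤ a := Nat.cast_nonneg a
    linarith
  obtain ⟨w, hw⟩ := hG.exists_quasirandomWeight (lt_of_lt_of_le one_pos ((le_max_right _ _).trans hn))
  have hV : a * n ≤ Fintype.card V := by
    have h1 := Nat.le_ceil ((a + 3 : ℝ) * n)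
    rw [← hG.card_eq] at h1
    have h2 : ((a * n : ℕ) : ℝ) ≤ Fintype.card V := by
      push_cast
      have : (0 : ℝ) ≤ n := Nat.cast_nonneg n
      linarith
    exact_mod_cast h2
  exact h n ((le_max_left _ _).trans hn) V G w hV hw K hK (fun i => χ.labelGraph i) fun x y hxy =>
    ⟨χ ⟨s(x, y), hxy⟩, (SimpleGraph.EdgeLabeling.labelGraph_adj x y).2 ⟨hxy, rfl⟩⟩
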